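/- Let $l$ be a prime number and let $K$ be a finite extension of $\mathbf{Q}_l$ containing a primitive $l$-th root of $1$. Let $\mathfrak{o}$ be the ring of integers of $K$, $\mathfrak{p}$ its maximal ideal, $v_K$ the normalised valuation, $e=v_K(l)$ the absolute ramification index of $K$, and $e_1=e/(l-1)$, which is an integer. For $n>0$ let $U_n=\mathrm{Ker}(\mathfrak{o}^\times\to(\mathfrak{o}/\mathfrak{p}^n)^\times)$ and let $\bar U_n$ be the image of $U_n$ in $K^\times/K^{\times l}$; by convention put $\bar U_0=K^\times/K^{\times l}$. Let $D\neq\bar U_{le_1}$ be an $\mathbf{F}_l$-line in $K^\times/K^{\times l}$, that is, a subgroup of order $l$. Then there is a unique integer $m\ge 0$, the level of $D$, such that $D\subset\bar U_m$ but $D\not\subset\bar U_{m+1}$, and $m<le_1$. The extension $L=K(\sqrt[l]{D})$, obtained by adjoining to $K$ all $l$-th roots of the elements of $K^\times$ whose class lies in $D$, is a ramified cyclic extension of $K$ of degree $l$, and its discriminant $d_{L|K}$, defined up to squares of units as the discriminant of any $\mathfrak{o}$-basis of the ring of integers $\mathfrak{o}_L$ of $L$ (such bases exist), satisfies $$v_K(d_{L|K})=(l-1)(1+le_1-m).$$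 Moreover, the ramification break of $L|K$ is $t=le_1-m$: writing $G=\mathrm{Gal}(L|K)$, $\mathfrak{l}_L$ for the maximal ideal of $\mathfrak{o}_L$, and $G_n$ for the group of those $\sigma\in G$ which act trivially on $\mathfrak{o}_L/\mathfrak{l}_L^{n+1}$, one has $G_t=G$ and $G_{t+1}=\{1\}$. -/

import Mathlib

namespace LocalKummer

open IsLocalRing

section Integers

variable (l : ℕ) [Fact l.Prime]

/-- For an algebraic extension `F` of `ℚ_l`, being integral over `ℤ_l` is the same as having
spectral norm at most `1`. -/
theorem isIntegral_iff_spectralNorm {F : Type*} [Field F] [Algebra ℚ_[l] F] [Algebra ℤ_[l] F]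
    [IsScalarTower ℤ_[l] ℚ_[l] F] [Algebra.IsAlgebraic ℚ_[l] F] (x : F) :
    IsIntegral ℤ_[l] x ↔ spectralNorm ℚ_[l] F x ≤ 1 := by
  have hx : IsIntegral ℚ_[l] x := Algebra.IsIntegral.isIntegral x
  rw [spectralNorm, spectralValue_le_one_iff (minpoly.monic hx)]
  constructor
  · intro h n
    rw [minpoly.isIntegrallyClosed_eq_field_fractions' ℚ_[l] h, Polynomial.coeff_map]
    exact PadicInt.norm_le_one _
  · intro h
    have hlift : minpoly ℚ_[l] x ∈ Polynomial.lifts (algebraMap ℤ_[l] ℚ_[l]) := by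
      rw [Polynomial.lifts_iff_coeff_lifts]
      intro n
      exact ⟨⟨_, h n⟩, rfl⟩
    obtain ⟨q, hq, -, hqm⟩ :=
      Polynomial.lifts_and_natDegree_eq_and_monic hlift (minpoly.monic hx)
    refine ⟨q, hqm, ?_⟩
    have h2 : Polynomial.aeval x (q.map (algebraMap ℤ_[l] ℚ_[l])) = 0 := by
      rw [hq]; exact minpoly.aeval _ _
    rw [Polynomial.aeval_map_algebraMap] at h2
    exact h2

/-- The integral elements of an algebraic extension of `ℚ_l` form a local ring. -/
theorem isLocalRing_integralClosure (F : Type*) [Field F] [Algebra ℚ_[l] F] [Algebra ℤ_[l] F]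
    [IsScalarTower ℤ_[l] ℚ_[l] F] [Algebra.IsAlgebraic ℚ_[l] F] :
    IsLocalRing (integralClosure ℤ_[l] F) := by
  have key : ∀ a : integralClosure ℤ_[l] F,
      a ∈ nonunits (integralClosure ℤ_[l] F) ↔ spectralNorm ℚ_[l] F (a : F) < 1 := by
    intro a
    have ha : spectralNorm ℚ_[l] F (a : F) ≤ 1 := (isIntegral_iff_spectralNorm l _).1 a.2
    have hmul : ∀ x y : F, spectralNorm ℚ_[l] F (x * y)
        = spectralNorm ℚ_[l] F x * spectralNorm ℚ_[l] F y :=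
      fun x y => map_mul (spectralMulAlgNorm ℚ_[l] F) x y
    rw [mem_nonunits_iff, ← not_le, not_iff_not]
    constructor
    · rintro ⟨u, rfl⟩
      have h1 : ((u : integralClosure ℤ_[l] F) : F) * ((↑u⁻¹ : integralClosure ℤ_[l] F) : F)
          = 1 := by
        rw [← Subalgebra.coe_mul, Units.mul_inv, Subalgebra.coe_one]
      have h2 := hmul (u : integralClosure ℤ_[l] F) (↑u⁻¹ : integralClosure ℤ_[l] F)
      rw [h1, spectralNorm_one] at h2
      have h3 : spectralNorm ℚ_[l] F ((↑u⁻¹ : integralClosure ℤ_[l] F) : F) ≤ 1 :=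
        (isIntegral_iff_spectralNorm l _).1 (↑u⁻¹ : integralClosure ℤ_[l] F).2
      have h4 := spectralNorm_nonneg (K := ℚ_[l]) (u : F)
      nlinarith
    · intro h
      have h0 : (a : F) ≠ 0 := by
        intro h0
        rw [h0, spectralNorm_zero] at h
        linarith
      have h2 := hmul (a : F) (a : F)⁻¹
      rw [mul_inv_cancel₀ h0, spectralNorm_one, le_antisymm ha h, one_mul] at h2
      have h3 : (a : F)⁻¹ ∈ integralClosure ℤ_[l] F :=
        (isIntegral_iff_spectralNorm l _).2 h2.ge
      exact IsUnit.of_mul_eq_one ⟨_, h3⟩ (Subtype.ext (mul_inv_cancel₀ h0))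
  refine IsLocalRing.of_nonunits_add fun a b ha hb => ?_
  rw [key] at ha hb ⊢
  exact (isNonarchimedean_spectralNorm (K := ℚ_[l]) (L := F) (a : F) (b : F)).trans_lt
    (max_lt ha hb)

variable (K : Type*) [Field K] [Algebra ℚ_[l] K] [Algebra ℤ_[l] K] [IsScalarTower ℤ_[l] ℚ_[l] K]

/-- The ring of integers `𝔬` of a finite extension `K` of `ℚ_l`. -/
noncomputable abbrev integers : Subalgebra ℤ_[l] K := integralClosure ℤ_[l] K

instance isLocalRing_integers [FiniteDimensional ℚ_[l] K] : IsLocalRing (integers l K) :=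
  isLocalRing_integralClosure l K

instance isDiscreteValuationRing_integers [FiniteDimensional ℚ_[l] K] :
    IsDiscreteValuationRing (integers l K) := by
  have h1 : IsDedekindDomain (integers l K) := integralClosure.isDedekindDomain ℤ_[l] ℚ_[l] K
  have hinj : Function.Injective (algebraMap ℤ_[l] (integers l K)) := by
    have : Function.Injective (algebraMap ℤ_[l] K) := by
      rw [IsScalarTower.algebraMap_eq ℤ_[l] ℚ_[l] K]
      exact (algebraMap ℚ_[l] K).injective.comp (IsFractionRing.injective ℤ_[l] ℚ_[l])
    intro a b h
    exact this (congrArg Subtype.val h)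
  have h2 : ¬ IsField (integers l K) := fun h =>
    IsDiscreteValuationRing.not_isField ℤ_[l] (isField_of_isIntegral_of_isField hinj h)
  exact ((IsDiscreteValuationRing.TFAE (integers l K) h2).out 0 2).2 h1

/-- The absolute ramification index `e = v_K(l)` of `K | ℚ_l`. -/
noncomputable def absRamificationIndex [FiniteDimensional ℚ_[l] K] : ℕ :=
  (IsDiscreteValuationRing.addVal (integers l K) (l : integers l K)).toNat

/-- The quotient `e₁ = e / (l - 1)`. -/
noncomputable def e₁ [FiniteDimensional ℚ_[l] K] : ℕ := absRamificationIndex l K / (l - 1)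

/-- The group `K^× / K^{×l}`. -/
abbrev KummerQuotient (l : ℕ) (K : Type*) [Field K] : Type _ :=
  Kˣ ⧸ (powMonoidHom l : Kˣ →* Kˣ).range

/-- The subgroup `U_n = Ker(𝔬^× → (𝔬/𝔭^n)^×)` of `K^×`. -/
noncomputable def unitGroup [FiniteDimensional ℚ_[l] K] (n : ℕ) : Subgroup Kˣ :=
  (MonoidHom.ker (Units.map
    (Ideal.Quotient.mk (maximalIdeal (integers l K) ^ n) :
      integers l K →* integers l K ⧸ maximalIdeal (integers l K) ^ n))).map
    (Units.map ((integers l K).val : integers l K →* K))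

/-- The filtration `Ū_n` on `K^× / K^{×l}`: the image of `U_n` for `n > 0`, with the convention
`Ū_0 = K^× / K^{×l}`. -/
noncomputable def unitFiltration [FiniteDimensional ℚ_[l] K] : ℕ → Subgroup (KummerQuotient l K)
  | 0 => ⊤
  | n + 1 => (unitGroup l K (n + 1)).map (QuotientGroup.mk' _)

/-- `D` has level `m`: `D ⊂ Ū_m` but `D ⊄ Ū_{m+1}`. -/
def HasLevel [FiniteDimensional ℚ_[l] K] (D : Subgroup (KummerQuotient l K)) (m : ℕ) : Prop :=
  D ≤ unitFiltration l K m ∧ ¬ D ≤ unitFiltration l K (m + 1)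

/-- The extension `K(D^{1/l})` of `K`, inside an algebraic closure of `K`, obtained by adjoining
all `l`-th roots of all elements of `K^×` whose class modulo `l`-th powers lies in `D`. -/
noncomputable def kummerExtension (l : ℕ) (K : Type*) [Field K]
    (D : Subgroup (KummerQuotient l K)) : IntermediateField K (AlgebraicClosure K) :=
  IntermediateField.adjoin K
    {x | ∃ u : Kˣ, (u : KummerQuotient l K) ∈ D ∧ x ^ l = algebraMap K (AlgebraicClosure K) u}

variable (L : Type*) [Field L] [Algebra K L]

/-- The ring of integers `𝔬_L` of an algebraic extension `L` of `K`, as an `𝔬_K`-algebra. -/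
noncomputable abbrev extIntegers : Subalgebra (integers l K) L := integralClosure (integers l K) L

instance isLocalRing_extIntegers [FiniteDimensional ℚ_[l] K] [Algebra.IsAlgebraic K L] :
    IsLocalRing (extIntegers l K L) := by
  let : Algebra ℚ_[l] L := ((algebraMap K L).comp (algebraMap ℚ_[l] K)).toAlgebra
  let : Algebra ℤ_[l] L := ((algebraMap K L).comp (algebraMap ℤ_[l] K)).toAlgebra
  have : IsScalarTower ℚ_[l] K L := IsScalarTower.of_algebraMap_eq fun _ => rfl
  have : IsScalarTower ℤ_[l] K L := IsScalarTower.of_algebraMap_eq fun _ => rfl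
  have : IsScalarTower ℤ_[l] ℚ_[l] L := IsScalarTower.of_algebraMap_eq fun x => by
    rw [IsScalarTower.algebraMap_apply ℤ_[l] K L, IsScalarTower.algebraMap_apply ℤ_[l] ℚ_[l] K,
      IsScalarTower.algebraMap_apply ℚ_[l] K L]
  have : IsScalarTower ℤ_[l] (integers l K) L := IsScalarTower.of_algebraMap_eq fun _ => rfl
  have : Algebra.IsAlgebraic ℚ_[l] L := Algebra.IsAlgebraic.trans ℚ_[l] K L
  have := isLocalRing_integralClosure l L
  let φ : integralClosure ℤ_[l] L ≃+* extIntegers l K L :=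
    { toFun := fun x => ⟨x.1, IsIntegral.tower_top x.2⟩
      invFun := fun x => ⟨x.1, isIntegral_trans (R := ℤ_[l]) (A := integers l K) x.1 x.2⟩
      left_inv := fun _ => rfl
      right_inv := fun _ => rfl
      map_mul' := fun _ _ => rfl
      map_add' := fun _ _ => rfl }
  exact φ.isLocalRing

/-- `L | K` is unramified: `𝔭_K` generates the maximal ideal of `𝔬_L`. (Residue fields are perfect,
so there is no separability condition to impose.) -/
def IsUnramifiedExt [FiniteDimensional ℚ_[l] K] [Algebra.IsAlgebraic K L] : Prop :=
  (maximalIdeal (integers l K)).map (algebraMap (integers l K) (extIntegers l K L)) =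
    maximalIdeal (extIntegers l K L)

/-- `v_K(d_{L|K}) = N`, where `d_{L|K}` is the discriminant of an `𝔬_K`-basis of `𝔬_L` (well defined
up to squares of units): such a basis exists, and for each of them the discriminant has
normalised valuation `N`. -/
def DiscrValuationEq [FiniteDimensional ℚ_[l] K] (N : ℕ) : Prop :=
  (∃ n : ℕ, Nonempty (Module.Basis (Fin n) (integers l K) (extIntegers l K L))) ∧
  ∀ (n : ℕ) (b : Module.Basis (Fin n) (integers l K) (extIntegers l K L)),
    IsDiscreteValuationRing.addVal (integers l K) (Algebra.discr (integers l K) b) = N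

/-- The ramification group `G_n` (lower numbering, `n ≥ -1`): those `σ` in `Gal(L|K)` which act
trivially on `𝔬_L / 𝔭_L^{n+1}`. -/
noncomputable def ramificationGroup [FiniteDimensional ℚ_[l] K] [Algebra.IsAlgebraic K L] (n : ℤ) :
    Subgroup Gal(L/K) :=
  (maximalIdeal (extIntegers l K L) ^ (n + 1).toNat).inertia Gal(L/K)

/-- `t` is the ramification break: `t ≥ -1`, `G_t = G` and `G_{t+1} = {1}`. -/
def IsRamificationBreak [FiniteDimensional ℚ_[l] K] [Algebra.IsAlgebraic K L] (t : ℤ) : Prop :=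
  -1 ≤ t ∧ ramificationGroup l K L t = ⊤ ∧ ramificationGroup l K L (t + 1) = ⊥

end Integers

end LocalKummer

/-! Let c be the absolute value of a uniformizer ϖ of K. All sizes are measured by the extension of
the l-adic absolute value to an algebraic closure, for which |ζ - 1| = c^{e₁}. The proof rests on (1
+ y)^l ≈ 1 + y^l + l y: the term y^l dominates for |y| > |ζ - 1|, and l y for |y| < |ζ - 1|. At y =
(ζ - 1) z the two balance, and the map becomes z ↦ z^l - z on the residue field.

The balanced case bounds the last step of the filtration. The cokernel of z ↦ z^l - z has at most l
elements, and units closer to 1 than |ζ - 1|^l are l-th powers by a Krasner argument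
(`exists_pow_eq_of_near_one`), so Ū_{le₁} has order at most l (`card_unitFiltration_le`). A line
other than Ū_{le₁} is therefore not contained in it, which gives the level m < le₁.

Below le₁, pick u in D outside Ū_{m+1}. Since the residue field is perfect, an l-th power could be
split off if l divided v(u) (for m = 0) or v(u - 1) = m (for m > 0), and u would then lie deeper.
Hence x = α or x = α - 1, where α^l = u, satisfies |x|^l = c^s with l ∤ s, and K(α) is totally
ramified. Conjugates of α are at distance |ζ - 1| |α|, so |σx/x - 1|^l = c^t with t = le₁ - m. By
Bézout some π = x^a ϖ^b with a prime to l is a uniformizer, and raising to the power a preserves the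
distance to 1, so |σπ - π| = |π|^{t+1} (`exists_unif_of_not_dvd`). As 𝔬_L = 𝔬[π], this one number
determines the discriminant, a product over pairs of embeddings, and the break. -/

namespace LocalKummer

open IsLocalRing

/-! ### Binomial estimates and roots of unity for a nonarchimedean absolute value -/

section Nonarchimedean

variable {M : Type*} [Field M] {v : AbsoluteValue M ℝ}

theorem abv_sub_lt (hv : IsNonarchimedean v) {x y : M} {r : ℝ} (hx : v x < r) (hy : v y < r) :
    v (x - y) < r := by
  rw [sub_eq_add_neg]
  exact (hv x (-y)).trans_lt (max_lt hx (by rwa [map_neg_eq_map]))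

theorem abv_sub_le (hv : IsNonarchimedean v) {x y : M} {r : ℝ} (hx : v x ≤ r) (hy : v y ≤ r) :
    v (x - y) ≤ r := by
  rw [sub_eq_add_neg]
  exact (hv x (-y)).trans (max_le hx (by rwa [map_neg_eq_map]))

theorem abv_add_lt (hv : IsNonarchimedean v) {x y : M} {r : ℝ} (hx : v x < r) (hy : v y < r) :
    v (x + y) < r :=
  (hv x y).trans_lt (max_lt hx hy)

theorem abv_add_le (hv : IsNonarchimedean v) {x y : M} {r : ℝ} (hx : v x ≤ r) (hy : v y ≤ r) :
    v (x + y) ≤ r :=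
  (hv x y).trans (max_le hx hy)

theorem abv_eq_of_sub_lt (hv : IsNonarchimedean v) {x y : M} (h : v (x - y) < v y) :
    v x = v y := by
  have := hv.add_eq_right_of_lt h
  rwa [sub_add_cancel] at this

theorem abv_eq_of_sub_lt' (hv : IsNonarchimedean v) {x y : M} (h : v (x - y) < v x) :
    v x = v y := by
  rw [map_sub_rev] at h
  exact (abv_eq_of_sub_lt hv h).symm

theorem abv_sum_le (hv : IsNonarchimedean v) {ι : Type*} (s : Finset ι) (f : ι → M) {r : ℝ}
    (hr : 0 ≤ r) (h : ∀ i ∈ s, v (f i) ≤ r) : v (∑ i ∈ s, f i) ≤ r := by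
  classical
  induction s using Finset.induction_on with
  | empty => simpa
  | insert a s ha ih =>
    rw [Finset.sum_insert ha]
    exact abv_add_le hv (h _ (by simp)) (ih fun i hi => h i (by simp [hi]))

/-- The middle terms of the binomial expansion of `(1 + y) ^ p`, from the quadratic one on. -/
theorem abv_one_add_pow_prime_sub (hv : IsNonarchimedean v) {p : ℕ} (hp : p.Prime) {y : M}
    (hy : v y ≤ 1) :
    v ((1 + y) ^ p - 1 - y ^ p - p * y) ≤ v p * v y ^ 2 := by
  obtain ⟨n, rfl⟩ : ∃ n, p = n + 2 := ⟨p - 2, by have := hp.two_le; omega⟩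
  have key : (1 + y) ^ (n + 2) - 1 - y ^ (n + 2) - ((n + 2 : ℕ) : M) * y =
      ∑ i ∈ Finset.range n, y ^ (i + 2) * ((n + 2).choose (i + 2) : ℕ) := by
    rw [add_comm 1 y, add_pow, Finset.sum_range_succ, Finset.sum_range_succ',
      Finset.sum_range_succ']
    simp
    ring
  rw [key]
  refine abv_sum_le hv _ _ (by positivity) fun i hi => ?_
  obtain ⟨k, hk⟩ := hp.dvd_choose_self (k := i + 2) (by omega)
    (by have := Finset.mem_range.1 hi; omega)
  rw [hk, Nat.cast_mul, map_mul, map_mul, map_pow, pow_add]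
  have h1 : v (k : M) ≤ 1 := hv.apply_natCast_le_one
  have h2 : v y ^ i ≤ 1 := pow_le_one₀ (v.nonneg _) hy
  calc v y ^ i * v y ^ 2 * (v ((n + 2 : ℕ) : M) * v (k : M))
      ≤ 1 * v y ^ 2 * (v ((n + 2 : ℕ) : M) * 1) := by gcongr
    _ = _ := by ring

theorem abv_one_add_pow_prime_sub' (hv : IsNonarchimedean v) {p : ℕ} (hp : p.Prime) {y : M}
    (hy : v y ≤ 1) :
    v ((1 + y) ^ p - 1 - y ^ p) ≤ v p * v y := by
  have h1 := abv_one_add_pow_prime_sub hv hp hy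
  have h2 : v ((p : M) * y) ≤ v p * v y := by rw [map_mul]
  have h3 : v (p : M) * v y ^ 2 ≤ v p * v y := by
    have := v.nonneg y
    gcongr
    nlinarith
  simpa using abv_add_le hv (h1.trans h3) h2

/-- The linear term n δ dominates the expansion when n is a unit. This is what allows x to be
replaced by x^a, with a prime to l, without changing how far the Galois group moves it. -/
theorem abv_one_add_pow_sub_one (hv : IsNonarchimedean v) {n : ℕ} {δ : M} (hδ : v δ < 1)
    (hn : v (n : M) = 1) : v ((1 + δ) ^ n - 1) = v δ := by
  have key : ∀ n : ℕ, v ((1 + δ) ^ n - 1 - n * δ) ≤ v δ ^ 2 := by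
    intro n
    induction n with
    | zero => simp
    | succ n ih =>
      have : (1 + δ) ^ (n + 1) - 1 - ((n + 1 : ℕ) : M) * δ =
          ((1 + δ) ^ n - 1 - n * δ) * (1 + δ) + n * δ ^ 2 := by push_cast; ring
      rw [this]
      refine abv_add_le hv ?_ ?_
      · rw [map_mul]
        have h1 : v (1 + δ) ≤ 1 := abv_add_le hv (by simp) hδ.le
        calc _ ≤ v δ ^ 2 * 1 := by gcongr
          _ = _ := mul_one _
      · rw [map_mul, map_pow]
        have h1 : v (n : M) ≤ 1 := hv.apply_natCast_le_one
        calc _ ≤ 1 * v δ ^ 2 := by gcongr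
          _ = _ := one_mul _
  rcases eq_or_ne δ 0 with rfl | h0
  · simp
  have h0' : 0 < v δ := v.pos h0
  have h1 : v ((n : M) * δ) = v δ := by rw [map_mul, hn, one_mul]
  rw [← h1]
  refine abv_eq_of_sub_lt hv ((key n).trans_lt ?_)
  rw [h1]
  nlinarith

theorem abv_eq_one_of_pow_eq_one {ζ : M} {n : ℕ} (hn : n ≠ 0) (h : ζ ^ n = 1) : v ζ = 1 := by
  have h1 : v ζ ^ n = 1 := by rw [← map_pow, h, map_one]
  exact (pow_eq_one_iff_of_nonneg (v.nonneg _) hn).1 h1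

theorem abv_pow_sub_one_le (hv : IsNonarchimedean v) {ζ : M} (h : v ζ ≤ 1) (i : ℕ) :
    v (ζ ^ i - 1) ≤ v (ζ - 1) := by
  rw [← mul_geom_sum, map_mul]
  have : v (∑ j ∈ Finset.range i, ζ ^ j) ≤ 1 :=
    abv_sum_le hv _ _ zero_le_one fun j _ => by
      rw [map_pow]; exact pow_le_one₀ (v.nonneg _) h
  calc _ ≤ v (ζ - 1) * 1 := by gcongr
    _ = _ := mul_one _

/-- Each of ζ and η is a power of the other, and ζ - 1 divides ζ^i - 1 with an integral quotient. -/
theorem abv_sub_one_eq_of_primitiveRoot (hv : IsNonarchimedean v) {ζ η : M} {n : ℕ} (hn : n ≠ 0)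
    (hζ : IsPrimitiveRoot ζ n) (hη : IsPrimitiveRoot η n) : v (η - 1) = v (ζ - 1) := by
  have : NeZero n := ⟨hn⟩
  refine le_antisymm ?_ ?_
  · obtain ⟨i, -, rfl⟩ := hζ.eq_pow_of_pow_eq_one hη.pow_eq_one
    exact abv_pow_sub_one_le hv (abv_eq_one_of_pow_eq_one hn hζ.pow_eq_one).le i
  · obtain ⟨i, -, rfl⟩ := hη.eq_pow_of_pow_eq_one hζ.pow_eq_one
    exact abv_pow_sub_one_le hv (abv_eq_one_of_pow_eq_one hn hη.pow_eq_one).le i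

/-- The product of 1 - ζ^i over 0 < i < p is p, and all factors have the same absolute value. -/
theorem abv_primitiveRoot_sub_one_pow (hv : IsNonarchimedean v) {ζ : M} {p : ℕ} (hp : p.Prime)
    (hζ : IsPrimitiveRoot ζ p) : v (ζ - 1) ^ (p - 1) = v p := by
  obtain ⟨n, rfl⟩ : ∃ n, p = n + 1 := ⟨p - 1, by have := hp.one_lt; omega⟩
  have h := hζ.prod_one_sub_pow_eq_order
  have h2 := congrArg v h
  rw [map_prod] at h2
  push_cast
  rw [← h2, Finset.prod_eq_pow_card (b := v (ζ - 1)) fun i hi => ?_,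
    Finset.card_range]
  rw [map_sub_rev v 1]
  refine (abv_sub_one_eq_of_primitiveRoot hv hp.ne_zero hζ
    (hζ.pow_of_coprime _ ?_))
  exact (Nat.coprime_of_lt_prime (by omega) (by simpa using hi) hp).symm

/-- Among the `n`-th roots of `u`, one is at distance at most `v (u - 1) ^ (1 / n)` from `1`. -/
theorem exists_root_near_one {ζ α u : M} {n : ℕ} (hn : 0 < n)
    (hζ : IsPrimitiveRoot ζ n) (hα : α ^ n = u) : ∃ i : ℕ, v (ζ ^ i * α - 1) ^ n ≤ v (u - 1) := by
  -- Evaluating X^n - u = ∏ (X - ζ^i α) at 1 writes 1 - u as a product of n factors; the n-th power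
  -- of the smallest one is at most the product.
  obtain ⟨i, hi, hmin⟩ := Finset.exists_min_image (Finset.range n) (fun i => v (ζ ^ i * α - 1))
    ⟨0, by simpa⟩
  refine ⟨i, ?_⟩
  have h := congrArg (Polynomial.eval 1) (X_pow_sub_C_eq_prod hζ hn hα)
  simp only [Polynomial.eval_prod, Polynomial.eval_sub, Polynomial.eval_pow, Polynomial.eval_X,
    Polynomial.eval_C, one_pow] at h
  rw [map_sub_rev v u, h, map_prod]
  calc v (ζ ^ i * α - 1) ^ n = ∏ j ∈ Finset.range n, v (ζ ^ i * α - 1) := by simp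
    _ ≤ _ := Finset.prod_le_prod (fun _ _ => v.nonneg _) fun j hj => by
      rw [map_sub_rev v 1]; exact hmin j hj

end Nonarchimedean

/-! ### Subalgebras that are unit balls of an absolute value (applied to both 𝔬 and 𝔬_L) -/

section ValuationSubalgebra

variable {A M : Type*} [CommRing A] [Field M] [Algebra A M] {C : Subalgebra A M}
  {v : AbsoluteValue M ℝ}

theorem isUnit_iff_abv_eq_one (hC : ∀ x, x ∈ C ↔ v x ≤ 1) (x : C) : IsUnit x ↔ v x = 1 := by
  constructor
  · rintro ⟨u, rfl⟩
    have h1 := (hC _).1 (u : C).2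
    have h2 := (hC _).1 (↑u⁻¹ : C).2
    have h3 : ((u : C) : M) * ((↑u⁻¹ : C) : M) = 1 := by
      rw [← Subalgebra.coe_mul, Units.mul_inv, Subalgebra.coe_one]
    have h4 := congrArg v h3
    rw [map_mul, map_one] at h4
    have := v.nonneg ((u : C) : M)
    nlinarith
  · intro h
    have h0 : (x : M) ≠ 0 := fun h0 => by simp [h0] at h
    exact IsUnit.of_mul_eq_one ⟨(x : M)⁻¹, (hC _).2 (by rw [map_inv₀, h, inv_one])⟩
      (Subtype.ext (mul_inv_cancel₀ h0))

theorem dvd_iff_abv_le (hC : ∀ x, x ∈ C ↔ v x ≤ 1) {x y : C} : x ∣ y ↔ v y ≤ v x := by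
  constructor
  · rintro ⟨z, rfl⟩
    rw [Subalgebra.coe_mul, map_mul]
    exact mul_le_of_le_one_right (v.nonneg _) ((hC _).1 z.2)
  · intro h
    rcases eq_or_ne x 0 with rfl | hx
    · rw [ZeroMemClass.coe_zero, map_zero] at h
      have : (y : M) = 0 := v.eq_zero.1 (le_antisymm h (v.nonneg _))
      rw [show y = 0 from Subtype.ext this]
    have hx' : (x : M) ≠ 0 := fun h => hx (Subtype.ext h)
    refine ⟨⟨y / x, (hC _).2 ?_⟩, Subtype.ext (mul_div_cancel₀ _ hx').symm⟩
    rw [map_div₀]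
    exact div_le_one_of_le₀ h (v.nonneg _)

theorem mem_maximalIdeal_pow_iff_abv_le [IsLocalRing C] (hC : ∀ x, x ∈ C ↔ v x ≤ 1) {ϖ : M}
    (h1 : v ϖ < 1) (hmax : ∀ x, v x < 1 → v x ≤ v ϖ) (x : C) (n : ℕ) :
    x ∈ maximalIdeal C ^ n ↔ v x ≤ v ϖ ^ n := by
  have hspan : maximalIdeal C = Ideal.span {(⟨ϖ, (hC _).2 h1.le⟩ : C)} := by
    ext y
    rw [Ideal.mem_span_singleton, dvd_iff_abv_le hC, mem_maximalIdeal, mem_nonunits_iff,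
      isUnit_iff_abv_eq_one hC]
    exact ⟨fun h => hmax _ (lt_of_le_of_ne ((hC _).1 y.2) h), fun h => (h.trans_lt h1).ne⟩
  rw [hspan, Ideal.span_singleton_pow, Ideal.mem_span_singleton, dvd_iff_abv_le hC,
    Subalgebra.coe_pow, map_pow]

/-- A family of elements of a subalgebra which is linearly independent over the fraction field and
spans the subalgebra is a basis. -/
theorem exists_basis_of_linearIndependent {K : Type*} [Field K] [Algebra A K] [Algebra K M]
    [IsScalarTower A K M] (hinj : Function.Injective (algebraMap A K)) {ι : Type*} [Fintype ι]
    {x : ι → M} (hx : ∀ i, x i ∈ C) (hli : LinearIndependent K x)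
    (hspan : ∀ z ∈ C, ∃ a : ι → A, z = ∑ i, algebraMap A K (a i) • x i) :
    ∃ b : Module.Basis ι A C, ∀ i, (b i : M) = x i := by
  let y : ι → C := fun i => ⟨x i, hx i⟩
  have hcoe : ∀ a : ι → A, ((∑ i, a i • y i : C) : M) = ∑ i, algebraMap A K (a i) • x i := by
    intro a
    rw [AddSubmonoidClass.coe_finsetSum]
    refine Finset.sum_congr rfl fun i _ => ?_
    rw [algebraMap_smul]
    rfl
  have hli' : LinearIndependent A y := by
    rw [Fintype.linearIndependent_iff]
    intro a ha i
    have h : ((∑ i, a i • y i : C) : M) = 0 := by rw [ha, ZeroMemClass.coe_zero]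
    rw [hcoe] at h
    have := Fintype.linearIndependent_iff.1 hli _ h i
    exact hinj (by rw [this, map_zero])
  have hspan' : ⊤ ≤ Submodule.span A (Set.range y) := by
    intro z _
    obtain ⟨a, ha⟩ := hspan z z.2
    rw [show z = ∑ i, a i • y i from Subtype.ext (ha.trans (hcoe a).symm)]
    exact Submodule.sum_mem _ fun i _ => Submodule.smul_mem _ _ (Submodule.subset_span ⟨i, rfl⟩)
  exact ⟨Module.Basis.mk hli' hspan', fun i => by rw [Module.Basis.mk_apply]⟩

end ValuationSubalgebra

theorem kummerQuotient_eq_iff {l : ℕ} {K : Type*} [Field K] {u w : Kˣ} :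
    (u : KummerQuotient l K) = w ↔ ∃ b : Kˣ, w = u * b ^ l := by
  rw [QuotientGroup.eq]
  constructor
  · rintro ⟨b, hb⟩
    exact ⟨b, by rw [show b ^ l = u⁻¹ * w from hb]; simp⟩
  · rintro ⟨b, rfl⟩
    exact ⟨b, by simp⟩

theorem isAlgebraic_algebraicClosure (l : ℕ) [Fact l.Prime] (K : Type*) [Field K]
    [Algebra ℚ_[l] K] [FiniteDimensional ℚ_[l] K] :
    Algebra.IsAlgebraic ℚ_[l] (AlgebraicClosure K) :=
  Algebra.IsAlgebraic.trans ℚ_[l] K (AlgebraicClosure K)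

/-! ### The absolute value on K and its closure; translation of ideals and unit groups into
inequalities -/

section SpectralAbsoluteValue

variable (l : ℕ) [Fact l.Prime]
variable (K : Type*) [Field K] [Algebra ℚ_[l] K] [FiniteDimensional ℚ_[l] K]

/-- The extension of the `l`-adic absolute value to the algebraic closure of `K`. -/
noncomputable def closureAbs : AbsoluteValue (AlgebraicClosure K) ℝ :=
  have := isAlgebraic_algebraicClosure l K
  { toFun := spectralNorm ℚ_[l] (AlgebraicClosure K)
    map_mul' := fun x y => map_mul (spectralMulAlgNorm ℚ_[l] (AlgebraicClosure K)) x y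
    nonneg' := fun x => spectralNorm_nonneg x
    eq_zero' := fun x => ⟨fun h => eq_zero_of_map_spectralNorm_eq_zero h
      (Algebra.IsAlgebraic.isAlgebraic x), fun h => by rw [h, spectralNorm_zero]⟩
    add_le' := fun x y => (isNonarchimedean_spectralNorm (K := ℚ_[l])
      (L := AlgebraicClosure K)).add_le (fun x => spectralNorm_nonneg x) }

theorem closureAbs_apply (x : AlgebraicClosure K) :
    closureAbs l K x = spectralNorm ℚ_[l] (AlgebraicClosure K) x := rfl

theorem isNonarchimedean_closureAbs : IsNonarchimedean (closureAbs l K) :=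
  have := isAlgebraic_algebraicClosure l K
  isNonarchimedean_spectralNorm (K := ℚ_[l]) (L := AlgebraicClosure K)

/-- The spectral norm depends only on the minimal polynomial over `ℚ_[l]`, which embeddings
preserve. -/
theorem closureAbs_algHom (L : IntermediateField K (AlgebraicClosure K))
    (f : L →ₐ[K] AlgebraicClosure K) (x : L) :
    closureAbs l K (f x) = closureAbs l K (x : AlgebraicClosure K) := by
  have h1 := minpoly.algHom_eq (f.restrictScalars ℚ_[l]) f.injective x
  have h2 := minpoly.algHom_eq (L.val.restrictScalars ℚ_[l]) L.val.injective x
  rw [closureAbs_apply, closureAbs_apply, spectralNorm, spectralNorm]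
  exact congrArg spectralValue (h1.trans h2.symm)

theorem closureAbs_algEquiv (σ : AlgebraicClosure K ≃ₐ[K] AlgebraicClosure K)
    (x : AlgebraicClosure K) : closureAbs l K (σ x) = closureAbs l K x :=
  (spectralNorm_eq_of_equiv (σ.restrictScalars ℚ_[l]) x).symm

/-- The absolute value of `K` extending the `l`-adic one. -/
noncomputable def baseAbs : AbsoluteValue K ℝ :=
  (closureAbs l K).comp (algebraMap K (AlgebraicClosure K)).injective

theorem closureAbs_algebraMap (x : K) :
    closureAbs l K (algebraMap K (AlgebraicClosure K) x) = baseAbs l K x := rfl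

theorem isNonarchimedean_baseAbs : IsNonarchimedean (baseAbs l K) := fun x y => by
  rw [← closureAbs_algebraMap, map_add]
  exact isNonarchimedean_closureAbs l K _ _

theorem baseAbs_prime_lt_one : baseAbs l K l < 1 := by
  have : Algebra.IsAlgebraic ℚ_[l] (AlgebraicClosure K) := isAlgebraic_algebraicClosure l K
  have h : (algebraMap K (AlgebraicClosure K) l) = algebraMap ℚ_[l] (AlgebraicClosure K) l := by simp
  rw [← closureAbs_algebraMap, h, closureAbs_apply, spectralNorm_extends]
  exact Padic.norm_p_lt_one

theorem baseAbs_natCast_of_coprime {n : ℕ} (h : n.Coprime l) : baseAbs l K n = 1 := by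
  have h1 : Int.gcd n l = 1 := h
  refine le_antisymm (isNonarchimedean_baseAbs l K).apply_natCast_le_one ?_
  by_contra! hlt
  have h2 := Int.gcd_eq_gcd_ab n l
  rw [h1] at h2
  have h3 : (1 : K) = n * ((Int.gcdA n l : ℤ) : K) + l * ((Int.gcdB n l : ℤ) : K) := by
    exact_mod_cast congrArg (fun z : ℤ => (z : K)) h2
  have h4 : ∀ z : ℤ, baseAbs l K z ≤ 1 := fun z =>
    (isNonarchimedean_baseAbs l K).apply_intCast_le_one
  have h5 : ∀ (m : ℕ) (z : ℤ), baseAbs l K m < 1 → baseAbs l K (m * z) < 1 := fun m z hm => by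
    rw [map_mul]
    exact (mul_le_of_le_one_right ((baseAbs l K).nonneg _) (h4 z)).trans_lt hm
  have h6 := abv_add_lt (isNonarchimedean_baseAbs l K) (h5 n (Int.gcdA n l) hlt)
    (h5 l (Int.gcdB n l) (baseAbs_prime_lt_one l K))
  rw [← h3, map_one] at h6
  exact lt_irrefl _ h6

variable [Algebra ℤ_[l] K] [IsScalarTower ℤ_[l] ℚ_[l] K]

theorem mem_integers_iff (x : K) : x ∈ integers l K ↔ baseAbs l K x ≤ 1 := by
  rw [← closureAbs_algebraMap, closureAbs_apply, ← spectralNorm.eq_of_tower]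
  exact isIntegral_iff_spectralNorm l x

theorem mem_extIntegers_iff (L : IntermediateField K (AlgebraicClosure K)) (x : L) :
    x ∈ extIntegers l K L ↔ closureAbs l K (x : AlgebraicClosure K) ≤ 1 := by
  have := isAlgebraic_algebraicClosure l K
  rw [closureAbs_apply, ← isIntegral_iff_spectralNorm l]
  have h1 : IsIntegral ℤ_[l] (x : AlgebraicClosure K) ↔ IsIntegral ℤ_[l] x :=
    isIntegral_algHom_iff (L.val.restrictScalars ℤ_[l]) L.val.injective
  rw [h1]
  have : IsScalarTower ℤ_[l] (integers l K) L := IsScalarTower.of_algebraMap_eq fun _ => rfl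
  exact ⟨fun h => isIntegral_trans (R := ℤ_[l]) (A := integers l K) x h,
    fun h => IsIntegral.tower_top h⟩

/-- A uniformizer of `K`. -/
noncomputable def uniformizer : integers l K :=
  (IsDiscreteValuationRing.exists_irreducible (integers l K)).choose

theorem irreducible_uniformizer : Irreducible (uniformizer l K) :=
  (IsDiscreteValuationRing.exists_irreducible (integers l K)).choose_spec

/-- The absolute value of a uniformizer. -/
noncomputable def unifAbs : ℝ := baseAbs l K (uniformizer l K)

theorem unifAbs_pos : 0 < unifAbs l K := by
  refine (baseAbs l K).pos fun h => (irreducible_uniformizer l K).ne_zero (Subtype.ext h)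

theorem isUnit_integers_iff (x : integers l K) : IsUnit x ↔ baseAbs l K x = 1 :=
  isUnit_iff_abv_eq_one (mem_integers_iff l K) x

theorem unifAbs_lt_one : unifAbs l K < 1 := by
  refine lt_of_le_of_ne ((mem_integers_iff l K _).1 (uniformizer l K).2) fun h => ?_
  exact (irreducible_uniformizer l K).not_isUnit ((isUnit_integers_iff l K _).2 h)

theorem exists_baseAbs_eq_zpow {x : K} (hx : x ≠ 0) : ∃ k : ℤ, baseAbs l K x = unifAbs l K ^ k := by
  have : IsFractionRing (integers l K) K :=
    integralClosure.isFractionRing_of_finite_extension ℚ_[l] K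
  obtain ⟨k, u, hu⟩ := IsDiscreteValuationRing.exists_units_eq_smul_zpow_of_irreducible
    (irreducible_uniformizer l K) hx
  refine ⟨k, ?_⟩
  rw [hu, Units.smul_def, Algebra.smul_def, map_mul, map_zpow₀]
  exact (congrArg (· * _) ((isUnit_integers_iff l K _).1 u.isUnit)).trans (one_mul _)

theorem unifAbs_zpow_le {a b : ℤ} : unifAbs l K ^ a ≤ unifAbs l K ^ b ↔ b ≤ a :=
  zpow_le_zpow_iff_right_of_lt_one₀ (unifAbs_pos l K) (unifAbs_lt_one l K)

theorem unifAbs_zpow_lt {a b : ℤ} : unifAbs l K ^ a < unifAbs l K ^ b ↔ b < a :=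
  zpow_lt_zpow_iff_right_of_lt_one₀ (unifAbs_pos l K) (unifAbs_lt_one l K)

theorem unifAbs_pow_le {a b : ℕ} : unifAbs l K ^ a ≤ unifAbs l K ^ b ↔ b ≤ a :=
  pow_le_pow_iff_right_of_lt_one₀ (unifAbs_pos l K) (unifAbs_lt_one l K)

theorem unifAbs_pow_lt {a b : ℕ} : unifAbs l K ^ a < unifAbs l K ^ b ↔ b < a :=
  pow_lt_pow_iff_right_of_lt_one₀ (unifAbs_pos l K) (unifAbs_lt_one l K)

theorem unifAbs_zpow_inj {a b : ℤ} (h : unifAbs l K ^ a = unifAbs l K ^ b) : a = b :=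
  zpow_right_injective₀ (unifAbs_pos l K) (unifAbs_lt_one l K).ne h

theorem baseAbs_le_unifAbs {x : K} (hx : baseAbs l K x < 1) : baseAbs l K x ≤ unifAbs l K := by
  rcases eq_or_ne x 0 with rfl | h0
  · rw [map_zero]; exact (unifAbs_pos l K).le
  obtain ⟨k, hk⟩ := exists_baseAbs_eq_zpow l K h0
  rw [hk, ← zpow_zero (unifAbs l K), unifAbs_zpow_lt] at hx
  rw [hk]
  conv_rhs => rw [← zpow_one (unifAbs l K)]
  rw [unifAbs_zpow_le]
  omega

theorem mem_maximalIdeal_pow_iff (x : integers l K) (n : ℕ) :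
    x ∈ maximalIdeal (integers l K) ^ n ↔ baseAbs l K x ≤ unifAbs l K ^ n :=
  mem_maximalIdeal_pow_iff_abv_le (mem_integers_iff l K) (unifAbs_lt_one l K)
    (fun _ => baseAbs_le_unifAbs l K) x n

theorem addVal_eq_iff (x : integers l K) (n : ℕ) :
    IsDiscreteValuationRing.addVal (integers l K) x = n ↔ baseAbs l K x = unifAbs l K ^ n := by
  have hpow : baseAbs l K ((uniformizer l K ^ n : integers l K) : K) = unifAbs l K ^ n := by
    rw [Subalgebra.coe_pow, map_pow]
    rfl
  have hC := mem_integers_iff l K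
  rw [← (irreducible_uniformizer l K).addVal_pow n,
    IsDiscreteValuationRing.addVal_eq_iff_associated, ← dvd_dvd_iff_associated,
    dvd_iff_abv_le hC, dvd_iff_abv_le hC, hpow, and_comm]
  exact le_antisymm_iff.symm

theorem baseAbs_prime : baseAbs l K l = unifAbs l K ^ absRamificationIndex l K := by
  have : CharZero (integers l K) := by
    have : CharZero K := charZero_of_injective_algebraMap (algebraMap ℚ_[l] K).injective
    exact charZero_of_injective_algebraMap (R := ℤ) (fun a b h => by
      have := congrArg (fun z : integers l K => (z : K)) h
      simpa using this)
  have h0 : (l : integers l K) ≠ 0 := Nat.cast_ne_zero.2 (Fact.out : l.Prime).ne_zero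
  -- The index is defined by `toNat`, which would send the value ⊤ to 0, so finiteness of v(l) has
  -- to be checked.
  have h1 : IsDiscreteValuationRing.addVal (integers l K) (l : integers l K) ≠ ⊤ := fun h =>
    h0 (IsDiscreteValuationRing.addVal_eq_top_iff.1 h)
  have h2 := (addVal_eq_iff l K (l : integers l K) (absRamificationIndex l K)).1
    (ENat.natCast_toNat h1).symm
  simpa using h2

theorem mem_unitGroup_iff {n : ℕ} (hn : n ≠ 0) (u : Kˣ) :
    u ∈ unitGroup l K n ↔ baseAbs l K (u - 1) ≤ unifAbs l K ^ n := by
  have key : ∀ w : integers l K, Ideal.Quotient.mk (maximalIdeal (integers l K) ^ n) w = 1 ↔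
      baseAbs l K ((w : K) - 1) ≤ unifAbs l K ^ n := fun w => by
    rw [← map_one (Ideal.Quotient.mk (maximalIdeal (integers l K) ^ n)), Ideal.Quotient.eq,
      mem_maximalIdeal_pow_iff]
    rfl
  rw [unitGroup, Subgroup.mem_map]
  constructor
  · rintro ⟨w, hw, rfl⟩
    refine (key w).1 ?_
    exact congrArg Units.val (MonoidHom.mem_ker.1 hw)
  · intro h
    have h1 : baseAbs l K (u - 1) < 1 :=
      h.trans_lt (pow_lt_one₀ (unifAbs_pos l K).le (unifAbs_lt_one l K) hn)
    have h2 : baseAbs l K (u : K) = 1 := by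
      rw [← (baseAbs l K).map_one]
      exact abv_eq_of_sub_lt (isNonarchimedean_baseAbs l K) (by simpa using h1)
    obtain ⟨w, hw⟩ := (isUnit_integers_iff l K ⟨u, (mem_integers_iff l K _).2 h2.le⟩).2 h2
    have hw' : ((w : integers l K) : K) = u := congrArg Subtype.val hw
    refine ⟨w, MonoidHom.mem_ker.2 (Units.ext ?_), Units.ext hw'⟩
    refine (key w).2 ?_
    rwa [hw']

theorem mem_unitFiltration_succ {n : ℕ} {x : KummerQuotient l K} :
    x ∈ unitFiltration l K (n + 1) ↔
      ∃ u : Kˣ, baseAbs l K (u - 1) ≤ unifAbs l K ^ (n + 1) ∧ (u : KummerQuotient l K) = x := by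
  change x ∈ (unitGroup l K (n + 1)).map (QuotientGroup.mk' _) ↔ _
  rw [Subgroup.mem_map]
  exact exists_congr fun u => and_congr_left fun _ => mem_unitGroup_iff l K n.succ_ne_zero u

theorem antitone_unitFiltration : Antitone (unitFiltration l K) := by
  refine antitone_nat_of_succ_le fun n => ?_
  cases n with
  | zero => exact le_top
  | succ n =>
    intro x hx
    rw [mem_unitFiltration_succ] at hx ⊢
    obtain ⟨u, hu, hx⟩ := hx
    exact ⟨u, hu.trans ((unifAbs_pow_le l K).2 (by omega)), hx⟩

end SpectralAbsoluteValue

/-! ### The residue field, units close to 1, and the order of Ū_{le₁} -/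

section UnitFiltration

variable (l : ℕ) [Fact l.Prime]
variable (K : Type*) [Field K] [Algebra ℚ_[l] K] [FiniteDimensional ℚ_[l] K]

section ResidueField

variable [Algebra ℤ_[l] K] [IsScalarTower ℤ_[l] ℚ_[l] K]

theorem finite_residueField : Finite (ResidueField (integers l K)) := by
  have : Module.Finite ℤ_[l] (integers l K) :=
    IsIntegralClosure.finite ℤ_[l] ℚ_[l] K (integers l K)
  have hinj : Function.Injective (algebraMap ℤ_[l] (integers l K)) := by
    have : Function.Injective (algebraMap ℤ_[l] K) := by
      rw [IsScalarTower.algebraMap_eq ℤ_[l] ℚ_[l] K]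
      exact (algebraMap ℚ_[l] K).injective.comp (IsFractionRing.injective ℤ_[l] ℚ_[l])
    intro a b h
    exact this (congrArg Subtype.val h)
  have : FaithfulSMul ℤ_[l] (integers l K) := (faithfulSMul_iff_algebraMap_injective _ _).2 hinj
  have : IsLocalHom (algebraMap ℤ_[l] (integers l K)) := inferInstance
  have : Finite (ResidueField ℤ_[l]) := Finite.of_equiv _ PadicInt.residueField.symm.toEquiv
  exact ResidueField.finite_of_finite (R := ℤ_[l]) this

theorem residue_eq_zero_iff_baseAbs (x : integers l K) :
    residue (integers l K) x = 0 ↔ baseAbs l K x < 1 := by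
  rw [residue_eq_zero_iff, mem_maximalIdeal, mem_nonunits_iff, isUnit_integers_iff,
    lt_iff_le_and_ne, and_iff_right ((mem_integers_iff l K _).1 x.2)]

theorem charP_residueField : CharP (ResidueField (integers l K)) l := by
  refine (CharP.charP_iff_prime_eq_zero Fact.out).2 ?_
  rw [← map_natCast (residue (integers l K)), residue_eq_zero_iff_baseAbs]
  exact baseAbs_prime_lt_one l K

/-- The residue field of `K` is perfect. -/
theorem exists_baseAbs_sub_pow_lt {a : K} (ha : baseAbs l K a ≤ 1) :
    ∃ b : K, baseAbs l K (a - b ^ l) < 1 := by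
  have := finite_residueField l K
  have := charP_residueField l K
  have : ExpChar (ResidueField (integers l K)) l := ExpChar.prime Fact.out
  have hs : Function.Surjective (frobenius (ResidueField (integers l K)) l) :=
    Finite.surjective_of_injective (frobenius_inj _ l)
  obtain ⟨y, hy⟩ := hs (residue _ ⟨a, (mem_integers_iff l K a).2 ha⟩)
  obtain ⟨b, rfl⟩ := residue_surjective y
  have h := (residue_eq_zero_iff_baseAbs l K (⟨a, (mem_integers_iff l K a).2 ha⟩ - b ^ l)).1
    (by rw [map_sub, map_pow, sub_eq_zero, ← hy, frobenius_def])
  rw [Subalgebra.coe_sub, Subalgebra.coe_pow] at h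
  exact ⟨b, h⟩

/-- The cokernel of `z ↦ z ^ l - z` on the residue field has at most `l` elements. -/
theorem exists_artinSchreier_classifier : ∃ (Q : Type) (_ : Finite Q) (F : integers l K → Q),
    Nat.card Q ≤ l ∧ ∀ a b, F a = F b →
      ∃ z : integers l K, baseAbs l K ((a : K) - b - ((z : K) ^ l - z)) < 1 := by
  classical
  have := finite_residueField l K
  have := charP_residueField l K
  have : ExpChar (ResidueField (integers l K)) l := ExpChar.prime Fact.out
  let f : ResidueField (integers l K) →+ ResidueField (integers l K) :=
    (frobenius (ResidueField (integers l K)) l : ResidueField (integers l K) →+* _).toAddMonoidHom -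
      AddMonoidHom.id _
  have hf : ∀ z, f z = z ^ l - z := fun z => rfl
  have hl := (Fact.out : l.Prime)
  have hcard : Nat.card (ResidueField (integers l K) ⧸ f.range) ≤ l := by
    -- For an endomorphism of a finite group the cokernel has as many elements as the kernel, which
    -- here consists of roots of X^l - X.
    change f.range.index ≤ l
    rw [AddSubgroup.index_range]
    have hne : (Polynomial.X ^ l - Polynomial.X : Polynomial (ResidueField (integers l K))) ≠ 0 :=
      FiniteField.X_pow_card_sub_X_ne_zero _ hl.one_lt
    have hsub : (f.ker : Set (ResidueField (integers l K))) ⊆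
        ((Polynomial.X ^ l - Polynomial.X :
          Polynomial (ResidueField (integers l K))).roots.toFinset : Set _) := by
      intro z hz
      have hz' : z ^ l - z = 0 := hz
      simpa [hne] using hz'
    calc Nat.card f.ker = (f.ker : Set (ResidueField (integers l K))).ncard := rfl
      _ ≤ _ := Set.ncard_le_ncard hsub (Finset.finite_toSet _)
      _ = _ := Set.ncard_coe_finset _
      _ ≤ _ := Multiset.toFinset_card_le _
      _ ≤ _ := Polynomial.card_roots' _
      _ = l := FiniteField.X_pow_card_sub_X_natDegree_eq _ hl.one_lt
  -- The quotient lives in the universe of K; numbering its elements moves it to `Type`.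
  let e := Finite.equivFin (ResidueField (integers l K) ⧸ f.range)
  refine ⟨Fin (Nat.card (ResidueField (integers l K) ⧸ f.range)), inferInstance,
    fun a => e (QuotientAddGroup.mk (residue _ a)), by simpa using hcard, fun a b hab => ?_⟩
  have h := e.injective hab
  rw [eq_comm, QuotientAddGroup.eq] at h
  obtain ⟨y, hy⟩ := h
  obtain ⟨z, rfl⟩ := residue_surjective y
  rw [hf] at hy
  have h := (residue_eq_zero_iff_baseAbs l K (a - b - (z ^ l - z))).1
    (by rw [map_sub, map_sub, map_sub, map_pow, hy]; ring)
  rw [Subalgebra.coe_sub, Subalgebra.coe_sub, Subalgebra.coe_sub, Subalgebra.coe_pow] at h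
  exact ⟨z, h⟩

end ResidueField

variable {l K} {ζ : K} (hζ : IsPrimitiveRoot ζ l)
include hζ

theorem baseAbs_zeta_sub_one_pow : baseAbs l K (ζ - 1) ^ (l - 1) = baseAbs l K l :=
  abv_primitiveRoot_sub_one_pow (isNonarchimedean_baseAbs l K) Fact.out hζ

theorem baseAbs_zeta_sub_one_pos : 0 < baseAbs l K (ζ - 1) :=
  (baseAbs l K).pos (sub_ne_zero.2 (hζ.ne_one (Fact.out : l.Prime).one_lt))

theorem baseAbs_zeta_sub_one_lt_one : baseAbs l K (ζ - 1) < 1 := by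
  by_contra! h
  have h1 := one_le_pow₀ h (n := l - 1)
  rw [baseAbs_zeta_sub_one_pow hζ] at h1
  exact h1.not_gt (baseAbs_prime_lt_one l K)

/-- A unit of `K` which is sufficiently close to `1` is an `l`-th power. -/
theorem exists_pow_eq_of_near_one {u : K}
    (hu : baseAbs l K (u - 1) < baseAbs l K (ζ - 1) ^ l) : ∃ b : K, b ^ l = u := by
  have hl := (Fact.out : l.Prime)
  have hv := isNonarchimedean_closureAbs l K
  have hζ' : IsPrimitiveRoot (algebraMap K (AlgebraicClosure K) ζ) l :=
    hζ.map_of_injective (algebraMap K (AlgebraicClosure K)).injective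
  have hζabs : closureAbs l K (algebraMap K (AlgebraicClosure K) ζ - 1) = baseAbs l K (ζ - 1) := by
    rw [← closureAbs_algebraMap, map_sub (algebraMap _ _), map_one]
  obtain ⟨α, hα⟩ := IsAlgClosed.exists_pow_nat_eq (algebraMap K (AlgebraicClosure K) u) hl.pos
  obtain ⟨i, hi⟩ := exists_root_near_one (v := closureAbs l K) hl.pos hζ' hα
  set β := algebraMap K (AlgebraicClosure K) ζ ^ i * α with hβ
  have hβl : β ^ l = algebraMap K (AlgebraicClosure K) u := by
    rw [hβ, mul_pow, ← pow_mul, mul_comm i, pow_mul, hζ'.pow_eq_one, one_pow, one_mul, hα]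
  have hβ1 : closureAbs l K (β - 1) < baseAbs l K (ζ - 1) := by
    refine lt_of_pow_lt_pow_left₀ l ((baseAbs l K).nonneg _) (hi.trans_lt ?_)
    rwa [← map_one (algebraMap K (AlgebraicClosure K)), ← map_sub, closureAbs_algebraMap]
  have hβabs : closureAbs l K β = 1 := by
    rw [← (closureAbs l K).map_one]
    refine abv_eq_of_sub_lt hv ?_
    rw [map_one]
    exact hβ1.trans (baseAbs_zeta_sub_one_lt_one hζ)
  have hβ0 : β ≠ 0 := fun h => by simp [h] at hβabs
  -- Characteristic zero makes the algebraic closure Galois over K, so elements fixed by all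
  -- automorphisms lie in K.
  have : CharZero K := charZero_of_injective_algebraMap (algebraMap ℚ_[l] K).injective
  have hfix : β ∈ (⊥ : IntermediateField K (AlgebraicClosure K)) := by
    rw [← InfiniteGalois.fixedField_bot]
    rintro ⟨σ, -⟩
    change σ β = β
    -- Krasner's argument: σβ = ηβ with η a primitive l-th root of unity, so |σβ - β| = |ζ - 1|,
    -- although β and σβ are both closer to 1 than |ζ - 1|.
    by_contra hne
    have hη : IsPrimitiveRoot (σ β / β) l := by
      have h1 : (σ β / β) ^ l = 1 := by
        rw [div_pow, ← map_pow, hβl, AlgEquiv.commutes, ← hβl, div_self (pow_ne_zero _ hβ0)]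
      have h2 : σ β / β ≠ 1 := fun h => hne ((div_eq_one_iff_eq hβ0).1 h)
      rw [← orderOf_eq_prime h1 h2]
      exact IsPrimitiveRoot.orderOf _
    have h1 := abv_sub_one_eq_of_primitiveRoot hv hl.ne_zero hζ' hη
    have h2 : σ β / β - 1 = ((σ (β - 1)) - (β - 1)) / β := by
      rw [map_sub, map_one]; field_simp; ring
    rw [h2, map_div₀, hβabs, div_one, hζabs] at h1
    refine (abv_sub_lt hv ?_ hβ1).ne h1
    rwa [closureAbs_algEquiv]
  obtain ⟨b, hb⟩ := IntermediateField.mem_bot.1 hfix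
  refine ⟨b, (algebraMap K (AlgebraicClosure K)).injective ?_⟩
  rw [map_pow, hb, hβl]

/-- With `y = (ζ - 1) z`, the power `(1 + y) ^ l` is `1 + (ζ - 1) ^ l (z ^ l - z)` up to terms of
higher order. -/
theorem baseAbs_one_add_pow_sub_lt {z : K} (hz : baseAbs l K z ≤ 1) :
    baseAbs l K ((1 + (ζ - 1) * z) ^ l - 1 - (ζ - 1) ^ l * (z ^ l - z)) <
      baseAbs l K (ζ - 1) ^ l := by
  have hl := (Fact.out : l.Prime)
  have hv := isNonarchimedean_baseAbs l K
  have h0 := baseAbs_zeta_sub_one_pos hζ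
  have h1 := baseAbs_zeta_sub_one_lt_one hζ
  have key : ∀ y : K, baseAbs l K y ≤ baseAbs l K (ζ - 1) →
      baseAbs l K ((1 + y) ^ l - 1 - y ^ l - l * y) < baseAbs l K (ζ - 1) ^ l := by
    intro y hy
    refine (abv_one_add_pow_prime_sub hv hl (hy.trans h1.le)).trans_lt ?_
    rw [← baseAbs_zeta_sub_one_pow hζ]
    calc _ ≤ baseAbs l K (ζ - 1) ^ (l - 1) * baseAbs l K (ζ - 1) ^ 2 := by
          have := (baseAbs l K).nonneg y
          gcongr
      _ = baseAbs l K (ζ - 1) ^ (l + 1) := by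
          rw [← pow_add]; congr 1; have := hl.one_lt; omega
      _ < _ := pow_lt_pow_right_of_lt_one₀ h0 h1 (Nat.lt_succ_self l)
  have hy : baseAbs l K ((ζ - 1) * z) ≤ baseAbs l K (ζ - 1) := by
    rw [map_mul]; exact mul_le_of_le_one_right h0.le hz
  have e1 := key _ hy
  -- At y = ζ - 1 the power (1 + y)^l is 1, so (ζ - 1)^l + l (ζ - 1) is negligible. Multiplied by z,
  -- this turns the linear term l (ζ - 1) z into -(ζ - 1)^l z.
  have e2 := key (ζ - 1) le_rfl
  rw [add_sub_cancel, hζ.pow_eq_one, sub_self, zero_sub] at e2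
  have e3 : baseAbs l K (z * (-(ζ - 1) ^ l - l * (ζ - 1))) < baseAbs l K (ζ - 1) ^ l := by
    rw [map_mul]
    exact (mul_le_of_le_one_left ((baseAbs l K).nonneg _) hz).trans_lt e2
  refine lt_of_eq_of_lt ?_ (abv_sub_lt hv e1 e3)
  congr 1
  rw [mul_pow]
  ring

variable [Algebra ℤ_[l] K] [IsScalarTower ℤ_[l] ℚ_[l] K]

/-- Comparing exponents in |ζ - 1|^(l-1) = |l| shows that l - 1 divides e, with quotient the
valuation of ζ - 1. -/
theorem exists_baseAbs_zeta_sub_one_eq :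
    baseAbs l K (ζ - 1) = unifAbs l K ^ e₁ l K ∧ (l - 1) * e₁ l K = absRamificationIndex l K := by
  have hl := (Fact.out : l.Prime)
  have hl1 : 0 < l - 1 := by have := hl.one_lt; omega
  obtain ⟨k, hk⟩ := exists_baseAbs_eq_zpow l K (sub_ne_zero.2 (hζ.ne_one hl.one_lt))
  have h := baseAbs_zeta_sub_one_pow hζ
  rw [hk, baseAbs_prime, ← zpow_natCast, ← zpow_natCast, ← zpow_mul] at h
  have h1 := unifAbs_zpow_inj l K h
  have h2 : 0 ≤ k := by
    by_contra! hneg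
    have : k * ((l - 1 : ℕ) : ℤ) < 0 := mul_neg_of_neg_of_pos hneg (by exact_mod_cast hl1)
    omega
  lift k to ℕ using h2
  have h3 : k * (l - 1) = absRamificationIndex l K := by exact_mod_cast h1
  have h4 : e₁ l K = k := by
    rw [e₁, ← h3]; exact Nat.mul_div_cancel _ hl1
  rw [h4, mul_comm, h3, hk, zpow_natCast]
  exact ⟨rfl, rfl⟩

theorem e₁_pos : 0 < e₁ l K := by
  rw [Nat.pos_iff_ne_zero]
  intro h
  have := (exists_baseAbs_zeta_sub_one_eq hζ).1
  rw [h, pow_zero] at this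
  exact (baseAbs_zeta_sub_one_lt_one hζ).ne this

theorem baseAbs_zeta_sub_one_pow_prime :
    baseAbs l K (ζ - 1) ^ l = unifAbs l K ^ (l * e₁ l K) := by
  rw [(exists_baseAbs_zeta_sub_one_eq hζ).1, ← pow_mul, mul_comm]

/-- A class is represented by u = 1 + (ζ - 1)^l a. If the residues of a and a' differ by some z^l -
z, then u and u' (1 + (ζ - 1) z)^l agree closely enough for their quotient to be an l-th power. So
the class of a modulo such differences determines that of u. -/
theorem card_unitFiltration_le :
    Finite (unitFiltration l K (l * e₁ l K)) ∧ Nat.card (unitFiltration l K (l * e₁ l K)) ≤ l := by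
  have hl := (Fact.out : l.Prime)
  have hv := isNonarchimedean_baseAbs l K
  have h0 := baseAbs_zeta_sub_one_pos hζ
  have h1 := baseAbs_zeta_sub_one_lt_one hζ
  obtain ⟨Q, _, F, hQ, hF⟩ := exists_artinSchreier_classifier l K
  have hmem : ∀ d : unitFiltration l K (l * e₁ l K), ∃ (u : Kˣ) (a : integers l K),
      (u : K) = 1 + (ζ - 1) ^ l * a ∧ (u : KummerQuotient l K) = d := by
    rintro ⟨d, hd⟩
    obtain ⟨n, hn⟩ : ∃ n, l * e₁ l K = n + 1 :=
      ⟨l * e₁ l K - 1, by have := Nat.mul_pos hl.pos (e₁_pos hζ); omega⟩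
    rw [hn, mem_unitFiltration_succ, ← hn, ← baseAbs_zeta_sub_one_pow_prime hζ] at hd
    obtain ⟨u, hu, rfl⟩ := hd
    have hne : (ζ - 1) ^ l ≠ 0 := pow_ne_zero _ (sub_ne_zero.2 (hζ.ne_one hl.one_lt))
    refine ⟨u, ⟨((u : K) - 1) / (ζ - 1) ^ l, (mem_integers_iff l K _).2 ?_⟩, ?_, rfl⟩
    · rw [map_div₀, map_pow]
      exact div_le_one_of_le₀ hu (by positivity)
    · change (u : K) = 1 + (ζ - 1) ^ l * (((u : K) - 1) / (ζ - 1) ^ l)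
      field_simp
      ring
  choose U A hUA hUd using hmem
  have hinj : Function.Injective fun d => F (A d) := by
    intro d d' h
    obtain ⟨z, hz⟩ := hF _ _ h
    have hzle := (mem_integers_iff l K _).1 z.2
    set u := (U d : K)
    set u' := (U d' : K)
    set w := 1 + (ζ - 1) * (z : K)
    have hAle := (mem_integers_iff l K _).1 (A d').2
    have hu'1 : baseAbs l K (u' - 1) < 1 := by
      rw [show u' = _ from hUA d', add_sub_cancel_left, map_mul, map_pow]
      exact (mul_le_of_le_one_right (by positivity) hAle).trans_lt (pow_lt_one₀ h0.le h1 hl.ne_zero)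
    have hu'abs : baseAbs l K u' = 1 := by
      rw [← (baseAbs l K).map_one]
      exact abv_eq_of_sub_lt hv (by simpa using hu'1)
    have hwabs : baseAbs l K w = 1 := by
      rw [← (baseAbs l K).map_one]
      refine abv_eq_of_sub_lt hv ?_
      rw [map_one, add_sub_cancel_left, map_mul]
      exact (mul_le_of_le_one_right h0.le hzle).trans_lt h1
    have hw0 : w ≠ 0 := fun h => by simp [h] at hwabs
    have hsmall := baseAbs_one_add_pow_sub_lt hζ hzle
    change baseAbs l K (w ^ l - 1 - (ζ - 1) ^ l * ((z : K) ^ l - z)) < _ at hsmall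
    have hpz : baseAbs l K ((ζ - 1) ^ l * ((z : K) ^ l - z)) ≤ baseAbs l K (ζ - 1) ^ l := by
      rw [map_mul, map_pow]
      refine mul_le_of_le_one_right (by positivity) (abv_sub_le hv ?_ hzle)
      rw [map_pow]
      exact pow_le_one₀ ((baseAbs l K).nonneg _) hzle
    have hw1 : baseAbs l K (w ^ l - 1) ≤ baseAbs l K (ζ - 1) ^ l := by
      simpa using abv_add_le hv hsmall.le hpz
    have t1 : baseAbs l K ((ζ - 1) ^ l * ((A d : K) - A d' - ((z : K) ^ l - z))) <
        baseAbs l K (ζ - 1) ^ l := by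
      rw [map_mul, map_pow]
      exact mul_lt_of_lt_one_right (by positivity) hz
    have t2 : baseAbs l K ((u' - 1) * (w ^ l - 1)) < baseAbs l K (ζ - 1) ^ l := by
      rw [map_mul]
      calc _ ≤ baseAbs l K (u' - 1) * baseAbs l K (ζ - 1) ^ l := by gcongr
        _ < _ := mul_lt_of_lt_one_left (by positivity) hu'1
    have t3 : baseAbs l K (u - u' * w ^ l) < baseAbs l K (ζ - 1) ^ l := by
      -- With P = (ζ - 1)^l and ℘ = z^l - z, the identity is u - u' w^l = P (a - a' - ℘) - (u' -
      -- 1)(w^l - 1) - (w^l - 1 - P ℘).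
      refine lt_of_eq_of_lt ?_ (abv_sub_lt hv (abv_sub_lt hv t1 t2) hsmall)
      congr 1
      rw [show u = _ from hUA d, show u' = _ from hUA d']
      ring
    have hu'0 : u' ≠ 0 := (U d').ne_zero
    have hprod : u' * w ^ l ≠ 0 := mul_ne_zero hu'0 (pow_ne_zero _ hw0)
    obtain ⟨b, hb⟩ := exists_pow_eq_of_near_one hζ (u := u / (u' * w ^ l)) (by
      rw [div_sub_one hprod, map_div₀, map_mul, map_pow, hu'abs, hwabs, one_pow, one_mul, div_one]
      exact t3)
    have hb0 : b ≠ 0 := by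
      rintro rfl
      rw [zero_pow hl.ne_zero, eq_comm, div_eq_zero_iff] at hb
      exact hb.elim (U d).ne_zero hprod
    have : (U d' : KummerQuotient l K) = U d := by
      rw [kummerQuotient_eq_iff]
      refine ⟨Units.mk0 (b * w) (mul_ne_zero hb0 hw0), Units.ext ?_⟩
      change u = u' * (b * w) ^ l
      rw [mul_pow, hb]
      field_simp
    exact Subtype.ext ((hUd d).symm.trans (this.symm.trans (hUd d')))
  exact ⟨Finite.of_injective _ hinj, (Nat.card_le_card_of_injective _ hinj).trans hQ⟩

end UnitFiltration

/-! ### Existence of the level and normal form of a generator -/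

section Level

variable {l : ℕ} [Fact l.Prime]
variable {K : Type*} [Field K] [Algebra ℚ_[l] K] [FiniteDimensional ℚ_[l] K]
variable [Algebra ℤ_[l] K] [IsScalarTower ℤ_[l] ℚ_[l] K]

theorem baseAbs_le_pow_succ {x : K} {n : ℕ} (h : baseAbs l K x < unifAbs l K ^ n) :
    baseAbs l K x ≤ unifAbs l K ^ (n + 1) := by
  rcases eq_or_ne x 0 with rfl | hx
  · rw [map_zero]; exact pow_nonneg (unifAbs_pos l K).le _
  obtain ⟨k, hk⟩ := exists_baseAbs_eq_zpow l K hx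
  rw [hk, ← zpow_natCast] at h ⊢
  rw [unifAbs_zpow_lt] at h
  rw [unifAbs_zpow_le]
  push_cast
  omega

/-- Dividing by an l-th power leaves the class unchanged, and discreteness of the valuation turns
the strict inequality into a gain of one step. It is applied to contradict u ∉ Ū_{n+1}. -/
theorem mem_unitFiltration_succ_of_lt {u : Kˣ} {w : K} (hw : w ≠ 0) {n : ℕ}
    (h : baseAbs l K (u / w ^ l - 1) < unifAbs l K ^ n) :
    (u : KummerQuotient l K) ∈ unitFiltration l K (n + 1) := by
  rw [mem_unitFiltration_succ]
  refine ⟨u / Units.mk0 w hw ^ l, ?_, ?_⟩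
  · simpa using baseAbs_le_pow_succ h
  · exact kummerQuotient_eq_iff.2 ⟨Units.mk0 w hw, by simp⟩

/-- An element of `K^×` which is not congruent to a principal unit modulo `l`-th powers has
valuation prime to `l`. -/
theorem not_dvd_of_notMem_unitFiltration_one {u : Kˣ} {s : ℤ}
    (hs : baseAbs l K u = unifAbs l K ^ s)
    (hu : (u : KummerQuotient l K) ∉ unitFiltration l K 1) : ¬ (l : ℤ) ∣ s := by
  rintro ⟨k, rfl⟩
  have hv := isNonarchimedean_baseAbs l K
  have hc := unifAbs_pos l K
  set ϖ : K := (uniformizer l K : K)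
  have hϖ : baseAbs l K ϖ = unifAbs l K := rfl
  have hϖ0 : ϖ ≠ 0 := fun h => hc.ne' (by rw [← hϖ, h, map_zero])
  have ha : baseAbs l K (u / ϖ ^ (l * k)) = 1 := by
    rw [map_div₀, map_zpow₀, hs, hϖ, div_self (zpow_ne_zero _ hc.ne')]
  -- Once ϖ^(lk) is removed, u is a unit, hence an l-th power modulo the maximal ideal; dividing by
  -- that power leaves a principal unit.
  obtain ⟨b, hb⟩ := exists_baseAbs_sub_pow_lt l K ha.le
  have hbl : baseAbs l K (b ^ l) = 1 := by
    rw [← ha]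
    exact (abv_eq_of_sub_lt' hv (by rwa [ha])).symm
  have hbl0 : b ^ l ≠ 0 := fun h => by simp [h] at hbl
  have hb0 : b ≠ 0 := fun h => hbl0 (by rw [h, zero_pow (Fact.out : l.Prime).ne_zero])
  refine hu (mem_unitFiltration_succ_of_lt (w := ϖ ^ k * b)
    (mul_ne_zero (zpow_ne_zero _ hϖ0) hb0) ?_)
  have : (u : K) / (ϖ ^ k * b) ^ l - 1 = (u / ϖ ^ (l * k) - b ^ l) / b ^ l := by
    rw [mul_pow, ← zpow_natCast (ϖ ^ k), ← zpow_mul, mul_comm k]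
    have := zpow_ne_zero (l * k) hϖ0
    field_simp
  rw [this, map_div₀, hbl, div_one, pow_zero]
  exact hb

variable {ζ : K} (hζ : IsPrimitiveRoot ζ l)
include hζ

/-- If m = lk, perfectness of the residue field gives u ≡ 1 + (ϖ^k b)^l modulo 𝔭^{m+1}, and dividing
by (1 + ϖ^k b)^l moves u into U_{m+1}. The remaining binomial terms do not interfere: their
valuation is at least e + k = (l - 1) e₁ + k, which exceeds lk because k < e₁. -/
theorem baseAbs_sub_one_of_level {u : Kˣ} {m : ℕ} (hm0 : 0 < m) (hm : m < l * e₁ l K)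
    (hum : baseAbs l K (u - 1) ≤ unifAbs l K ^ m)
    (hu : (u : KummerQuotient l K) ∉ unitFiltration l K (m + 1)) :
    baseAbs l K (u - 1) = unifAbs l K ^ m ∧ ¬ l ∣ m := by
  have hl := (Fact.out : l.Prime)
  have hv := isNonarchimedean_baseAbs l K
  have hc := unifAbs_pos l K
  refine ⟨?_, ?_⟩
  · refine hum.antisymm ?_
    by_contra! h
    exact hu (mem_unitFiltration_succ_of_lt one_ne_zero (by simpa using h))
  rintro ⟨k, rfl⟩
  have hk0 : 0 < k := Nat.pos_of_ne_zero (by rintro rfl; simp at hm0)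
  set ϖ : K := (uniformizer l K : K)
  have hϖ : baseAbs l K ϖ = unifAbs l K := rfl
  have hϖ0 : ϖ ≠ 0 := fun h => hc.ne' (by rw [← hϖ, h, map_zero])
  have ha : baseAbs l K ((u - 1) / ϖ ^ (l * k)) ≤ 1 := by
    rw [map_div₀, map_pow, hϖ]
    exact div_le_one_of_le₀ hum (by positivity)
  obtain ⟨b, hb⟩ := exists_baseAbs_sub_pow_lt l K ha
  have hb1 : baseAbs l K b ≤ 1 := by
    have h1 : baseAbs l K (b ^ l) ≤ 1 := by simpa using abv_sub_le hv ha hb.le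
    rw [map_pow] at h1
    exact (pow_le_one_iff_of_nonneg ((baseAbs l K).nonneg _) hl.ne_zero).1 h1
  have hy : baseAbs l K (ϖ ^ k * b) ≤ unifAbs l K ^ k := by
    rw [map_mul, map_pow, hϖ]
    exact mul_le_of_le_one_right (by positivity) hb1
  have hck : unifAbs l K ^ k < 1 := pow_lt_one₀ hc.le (unifAbs_lt_one l K) hk0.ne'
  have hw : baseAbs l K (1 + ϖ ^ k * b) = 1 := by
    rw [← (baseAbs l K).map_one]
    refine abv_eq_of_sub_lt hv ?_
    rw [map_one, add_sub_cancel_left]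
    exact hy.trans_lt hck
  have hw0 : 1 + ϖ ^ k * b ≠ 0 := fun h => by simp [h] at hw
  refine hu (mem_unitFiltration_succ_of_lt hw0 ?_)
  rw [div_sub_one (pow_ne_zero _ hw0), map_div₀, map_pow, hw, one_pow, div_one]
  have h1 : baseAbs l K ((1 + ϖ ^ k * b) ^ l - 1 - (ϖ ^ k * b) ^ l) < unifAbs l K ^ (l * k) := by
    refine (abv_one_add_pow_prime_sub' hv hl (hy.trans hck.le)).trans_lt ?_
    rw [baseAbs_prime, ← (exists_baseAbs_zeta_sub_one_eq hζ).2]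
    calc _ ≤ unifAbs l K ^ ((l - 1) * e₁ l K) * unifAbs l K ^ k := by gcongr
      _ = unifAbs l K ^ ((l - 1) * e₁ l K + k) := (pow_add _ _ _).symm
      _ < _ := by
        rw [unifAbs_pow_lt]
        have h2 : k < e₁ l K := Nat.lt_of_mul_lt_mul_left hm
        have h3 : l * k = (l - 1) * k + k := by
          rw [← Nat.succ_mul, Nat.succ_eq_add_one, Nat.sub_add_cancel hl.pos]
        rw [h3]
        have h4 : 0 < l - 1 := by have := hl.two_le; omega
        gcongr
  have h2 : baseAbs l K (ϖ ^ (l * k) * ((u - 1) / ϖ ^ (l * k) - b ^ l)) < unifAbs l K ^ (l * k) := by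
    rw [map_mul, map_pow, hϖ]
    exact mul_lt_of_lt_one_right (by positivity) hb
  refine lt_of_eq_of_lt ?_ (abv_sub_lt hv h2 h1)
  congr 1
  rw [mul_sub, mul_div_cancel₀ _ (pow_ne_zero _ hϖ0), mul_pow, ← pow_mul, mul_comm k]
  ring

/-- The absolute value of `α - 1`, where `α` is an `l`-th root of a unit of level `m`. -/
theorem closureAbs_root_sub_one_pow {u : K} {m : ℕ} (hm : m < l * e₁ l K)
    (hum : baseAbs l K (u - 1) = unifAbs l K ^ m) {α : AlgebraicClosure K}
    (hα : α ^ l = algebraMap K (AlgebraicClosure K) u) (hα1 : closureAbs l K α ≤ 1) :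
    closureAbs l K (α - 1) ^ l = unifAbs l K ^ m := by
  have hl := (Fact.out : l.Prime)
  have hv := isNonarchimedean_closureAbs l K
  have hc := unifAbs_pos l K
  have hx : closureAbs l K (α - 1) ≤ 1 := abv_sub_le hv hα1 (by simp)
  have h1 := abv_one_add_pow_prime_sub' hv hl hx
  have h2 : closureAbs l K ((l : ℕ) : AlgebraicClosure K) = baseAbs l K (ζ - 1) ^ (l - 1) := by
    rw [baseAbs_zeta_sub_one_pow hζ, ← closureAbs_algebraMap, map_natCast (algebraMap _ _)]
  have h3 : closureAbs l K (α ^ l - 1) = unifAbs l K ^ m := by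
    rw [hα, ← hum, ← closureAbs_algebraMap, map_sub (algebraMap _ _), map_one]
  rw [add_sub_cancel, h2] at h1
  have hr := (closureAbs l K).nonneg (α - 1)
  have hz := baseAbs_zeta_sub_one_pos hζ
  have hpow : ∀ r : ℝ, r ^ (l - 1) * r = r ^ l := fun r => pow_sub_one_mul hl.ne_zero r
  -- If |α - 1| ≤ |ζ - 1|, every term of α^l - 1 is at most |ζ - 1|^l = c^{le₁}, against m < le₁.
  -- Otherwise (α - 1)^l strictly dominates the remaining terms.
  rcases le_or_gt (closureAbs l K (α - 1)) (baseAbs l K (ζ - 1)) with hle | hlt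
  · exfalso
    have h4 : closureAbs l K ((α - 1) ^ l) ≤ baseAbs l K (ζ - 1) ^ l := by
      rw [map_pow]; gcongr
    have h5 : closureAbs l K (α ^ l - 1 - (α - 1) ^ l) ≤ baseAbs l K (ζ - 1) ^ l := by
      refine h1.trans ?_
      rw [← hpow (baseAbs l K (ζ - 1))]
      gcongr
    have h6 := abv_add_le hv h5 h4
    rw [sub_add_cancel, h3, baseAbs_zeta_sub_one_pow_prime hζ, unifAbs_pow_le] at h6
    omega
  · rw [← h3, ← map_pow]
    refine (abv_eq_of_sub_lt hv (h1.trans_lt ?_)).symm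
    rw [map_pow, ← hpow (closureAbs l K (α - 1))]
    have hr0 : 0 < closureAbs l K (α - 1) := hz.trans hlt
    have : l - 1 ≠ 0 := by have := hl.two_le; omega
    gcongr

/-- If m ≥ le₁, then D would lie in Ū_{le₁}, a group of order at most l = |D|, and so equal it. -/
theorem HasLevel.lt {D : Subgroup (KummerQuotient l K)} (hD : Nat.card D = l)
    (hne : D ≠ unitFiltration l K (l * e₁ l K)) {m : ℕ} (h : HasLevel l K D m) :
    m < l * e₁ l K := by
  by_contra! hle
  obtain ⟨hfin, hcard⟩ := card_unitFiltration_le (K := K) hζ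
  exact hne (Subgroup.eq_of_le_of_card_ge (h.1.trans (antitone_unitFiltration l K hle))
    (hcard.trans hD.ge))

theorem existsUnique_hasLevel {D : Subgroup (KummerQuotient l K)} (hD : Nat.card D = l)
    (hne : D ≠ unitFiltration l K (l * e₁ l K)) : ∃! m : ℕ, HasLevel l K D m := by
  classical
  have hanti := antitone_unitFiltration l K
  have hex : ∃ n, ¬ D ≤ unitFiltration l K n := by
    refine ⟨l * e₁ l K, fun hle => hne ?_⟩
    obtain ⟨hfin, hcard⟩ := card_unitFiltration_le (K := K) hζ
    exact Subgroup.eq_of_le_of_card_ge hle (hcard.trans hD.ge)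
  have hpos : Nat.find hex ≠ 0 := fun h0 => by
    have := Nat.find_spec hex
    rw [h0] at this
    exact this le_top
  refine ⟨Nat.find hex - 1, ⟨?_, ?_⟩, fun m hm => ?_⟩
  · exact not_not.1 (Nat.find_min hex (Nat.sub_one_lt hpos))
  · rw [Nat.sub_one_add_one hpos]
    exact Nat.find_spec hex
  · have h1 : Nat.find hex ≤ m + 1 := Nat.find_min' hex hm.2
    have h2 : m < Nat.find hex := by
      by_contra! h
      exact Nat.find_spec hex (hm.1.trans (hanti h))
    omega

/-- A Kummer generator `α` of a line of level `m`, and a translate `α - ε` of it whose valuation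
has denominator `l`. -/
theorem HasLevel.exists_generator {D : Subgroup (KummerQuotient l K)} {m : ℕ}
    (h : HasLevel l K D m) (hm : m < l * e₁ l K) :
    ∃ u : Kˣ, (u : KummerQuotient l K) ∈ D ∧ (u : KummerQuotient l K) ≠ 1 ∧
      ∀ α : AlgebraicClosure K, α ^ l = algebraMap K (AlgebraicClosure K) u →
        ∃ (ε : K) (s : ℤ), ¬ (l : ℤ) ∣ s ∧
          closureAbs l K (α - algebraMap K (AlgebraicClosure K) ε) ^ l = unifAbs l K ^ s ∧
          (baseAbs l K (ζ - 1) * closureAbs l K α) ^ l =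
            unifAbs l K ^ (l * e₁ l K - m) * unifAbs l K ^ s := by
  have hl := (Fact.out : l.Prime)
  obtain ⟨d, hdD, hd⟩ := SetLike.not_le_iff_exists.1 h.2
  have hd1 : d ≠ 1 := fun h1 => hd (h1 ▸ one_mem _)
  rcases Nat.eq_zero_or_pos m with rfl | hm0
  · obtain ⟨u, rfl⟩ := QuotientGroup.mk_surjective d
    refine ⟨u, hdD, hd1, fun α hα => ?_⟩
    obtain ⟨s, hs⟩ := exists_baseAbs_eq_zpow l K u.ne_zero
    have hαl : closureAbs l K α ^ l = unifAbs l K ^ s := by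
      rw [← map_pow, hα, closureAbs_algebraMap, hs]
    -- At level 0 the root α itself has valuation with denominator l, with s = v(u); no translation
    -- is needed.
    refine ⟨0, s, not_dvd_of_notMem_unitFiltration_one hs hd, by simpa using hαl, ?_⟩
    rw [mul_pow, hαl, baseAbs_zeta_sub_one_pow_prime hζ, Nat.sub_zero]
  · obtain ⟨n, rfl⟩ : ∃ n, m = n + 1 := ⟨m - 1, by omega⟩
    obtain ⟨u, hu, rfl⟩ := (mem_unitFiltration_succ l K).1 (h.1 hdD)
    obtain ⟨hum, hndvd⟩ := baseAbs_sub_one_of_level hζ hm0 hm hu hd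
    refine ⟨u, hdD, hd1, fun α hα => ?_⟩
    have hu1 : baseAbs l K u = 1 := by
      rw [← (baseAbs l K).map_one]
      refine abv_eq_of_sub_lt (isNonarchimedean_baseAbs l K) ?_
      rw [hum, map_one]
      exact pow_lt_one₀ (unifAbs_pos l K).le (unifAbs_lt_one l K) hm0.ne'
    have hα1 : closureAbs l K α = 1 := by
      refine (pow_eq_one_iff_of_nonneg ((closureAbs l K).nonneg _) hl.ne_zero).1 ?_
      rw [← map_pow, hα, closureAbs_algebraMap, hu1]
    -- At positive level α is a unit, so α - 1 is used instead, with s = m.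
    refine ⟨1, (n + 1 : ℕ), by exact_mod_cast hndvd, ?_, ?_⟩
    · rw [map_one, zpow_natCast]
      exact closureAbs_root_sub_one_pow hζ hm hum hα hα1.le
    · rw [hα1, mul_one, baseAbs_zeta_sub_one_pow_prime hζ, zpow_natCast, ← pow_add,
        Nat.sub_add_cancel hm.le]

end Level

theorem abv_pow_sub_pow_le {M : Type*} [Field M] {v : AbsoluteValue M ℝ} (hv : IsNonarchimedean v)
    {x y : M} (hx : v x ≤ 1) (hy : v y ≤ 1) (n : ℕ) : v (x ^ n - y ^ n) ≤ v (x - y) := by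
  induction n with
  | zero => simp
  | succ n ih =>
    have : x ^ (n + 1) - y ^ (n + 1) = x ^ n * (x - y) + (x ^ n - y ^ n) * y := by ring
    rw [this]
    refine abv_add_le hv ?_ ?_
    · rw [map_mul, map_pow]
      exact mul_le_of_le_one_left (v.nonneg _) (pow_le_one₀ (v.nonneg _) hx)
    · rw [map_mul]
      exact (mul_le_of_le_one_right (v.nonneg _) hy).trans ih

/-- L is the localization of C at the nonzero elements of A, and discriminants of bases are
compatible with localization. -/
theorem algebraMap_discr_integralClosure (A K L C : Type*) [CommRing A] [IsDomain A] [Field K]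
    [Algebra A K] [IsFractionRing A K] [Field L] [Algebra K L] [Algebra A L] [IsScalarTower A K L]
    [CommRing C] [Algebra A C] [Algebra C L] [IsScalarTower A C L] [IsIntegralClosure C A L]
    [Algebra.IsAlgebraic K L] {ι : Type*} [Fintype ι] [DecidableEq ι] (b : Module.Basis ι A C) :
    algebraMap A K (Algebra.discr A b) = Algebra.discr K (fun i => algebraMap C L (b i)) := by
  have : IsLocalization (Algebra.algebraMapSubmonoid C (nonZeroDivisors A)) L :=
    IsIntegralClosure.isLocalization A K L C
  have : Module.Finite A C := .of_basis b
  have : Module.Free A C := .of_basis b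
  rw [← Algebra.discr_localizationLocalization A (nonZeroDivisors A) L b]
  congr 1
  ext i
  rw [Module.Basis.localizationLocalization_apply]

/-! ### Integral structure of a degree l extension containing π with |π|^l = c -/

section TotallyRamified

variable {l : ℕ} [Fact l.Prime]
variable {K : Type*} [Field K] [Algebra ℚ_[l] K] [FiniteDimensional ℚ_[l] K]

variable (l) in
/-- The restriction of `closureAbs` to an intermediate field. -/
noncomputable def extAbs (L : IntermediateField K (AlgebraicClosure K)) : AbsoluteValue L ℝ :=
  (closureAbs l K).comp L.val.injective

variable {L : IntermediateField K (AlgebraicClosure K)}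

theorem extAbs_apply (x : L) : extAbs l L x = closureAbs l K (x : AlgebraicClosure K) := rfl

theorem extAbs_algebraMap (x : K) : extAbs l L (algebraMap K L x) = baseAbs l K x := rfl

theorem isNonarchimedean_extAbs : IsNonarchimedean (extAbs l L) := fun x y =>
  isNonarchimedean_closureAbs l K (x : AlgebraicClosure K) y

theorem extAbs_algEquiv (σ : Gal(L/K)) (x : L) : extAbs l L (σ x) = extAbs l L x :=
  closureAbs_algHom l K L (L.val.comp (σ : L →ₐ[K] L)) x

variable [Algebra ℤ_[l] K] [IsScalarTower ℤ_[l] ℚ_[l] K]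

theorem algebraMap_discr_extIntegers [FiniteDimensional K L] {ι : Type*} [Fintype ι]
    [DecidableEq ι] (b : Module.Basis ι (integers l K) (extIntegers l K L)) :
    ((Algebra.discr (integers l K) b : integers l K) : K) =
      Algebra.discr K (fun i => (b i : L)) := by
  have : IsFractionRing (integers l K) K :=
    integralClosure.isFractionRing_of_finite_extension ℚ_[l] K
  exact algebraMap_discr_integralClosure (integers l K) K L (extIntegers l K L) b

variable {π : L} (hπ : extAbs l L π ^ l = unifAbs l K)
include hπ

theorem extAbs_unif_pos : 0 < extAbs l L π := by
  refine lt_of_le_of_ne ((extAbs l L).nonneg _) fun h => ?_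
  rw [← h, zero_pow (Fact.out : l.Prime).ne_zero] at hπ
  exact (unifAbs_pos l K).ne hπ

theorem extAbs_unif_lt_one : extAbs l L π < 1 :=
  lt_of_pow_lt_pow_left₀ l zero_le_one (by rw [hπ, one_pow]; exact unifAbs_lt_one l K)

theorem extAbs_smul_pow_pow {a : K} {k : ℤ} (hk : baseAbs l K a = unifAbs l K ^ k) (i : ℕ) :
    extAbs l L (a • π ^ i) ^ l = unifAbs l K ^ (l * k + i : ℤ) := by
  rw [Algebra.smul_def, map_mul, map_pow, extAbs_algebraMap, hk, mul_pow, ← pow_mul, mul_comm i,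
    pow_mul, hπ, ← zpow_natCast, ← zpow_natCast, ← zpow_mul, ← zpow_add₀ (unifAbs_pos l K).ne',
    mul_comm k]

/-- The powers of a uniformizer of a totally ramified extension are orthogonal. -/
theorem extAbs_smul_pow_le_sum (a : Fin l → K) (i : Fin l) :
    extAbs l L (a i • π ^ (i : ℕ)) ≤ extAbs l L (∑ j, a j • π ^ (j : ℕ)) := by
  have hv := isNonarchimedean_extAbs (l := l) (L := L)
  obtain ⟨k, -, hk⟩ := Finset.exists_max_image Finset.univ
    (fun j : Fin l => extAbs l L (a j • π ^ (j : ℕ))) ⟨i, Finset.mem_univ _⟩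
  have hik := hk i (Finset.mem_univ _)
  rcases eq_or_ne (a k) 0 with h0 | h0
  · rw [h0, zero_smul, map_zero] at hik
    exact hik.trans ((extAbs l L).nonneg _)
  refine hik.trans_eq (Eq.symm ?_)
  -- The maximal term is unique: the l-th power of the j-th nonzero term is c to an exponent
  -- congruent to j modulo l, so no two nonzero terms have the same size.
  refine hv.apply_sum_eq_of_lt (fun _ => (map_neg_eq_map _ _).symm) (Finset.mem_univ k)
    fun j _ hjk => lt_of_le_of_ne (hk j (Finset.mem_univ _)) fun heq => hjk ?_
  have hpos : extAbs l L (a k • π ^ (k : ℕ)) ≠ 0 := by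
    rw [(extAbs l L).ne_zero_iff]
    refine smul_ne_zero h0 (pow_ne_zero _ fun h => ?_)
    exact (extAbs_unif_pos hπ).ne' (by rw [h, map_zero])
  have hj0 : a j ≠ 0 := fun h => hpos (by rw [← heq, h, zero_smul, map_zero])
  obtain ⟨p, hp⟩ := exists_baseAbs_eq_zpow l K hj0
  obtain ⟨q, hq⟩ := exists_baseAbs_eq_zpow l K h0
  have h1 := congrArg (· ^ l) heq
  simp only [extAbs_smul_pow_pow hπ hp, extAbs_smul_pow_pow hπ hq] at h1
  have h2 := unifAbs_zpow_inj l K h1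
  have h3 : (j : ℤ) ≡ k [ZMOD l] := by
    have := congrArg (· % (l : ℤ)) h2
    simpa [Int.ModEq] using this
  have h4 : (j : ℕ) ≡ k [MOD l] := by exact_mod_cast h3
  exact Fin.ext (h4.eq_of_lt_of_lt j.2 k.2)

theorem linearIndependent_pow_unif : LinearIndependent K fun i : Fin l => π ^ (i : ℕ) := by
  rw [Fintype.linearIndependent_iff]
  intro a ha i
  have h := extAbs_smul_pow_le_sum hπ a i
  rw [ha, map_zero] at h
  have h1 := (extAbs l L).eq_zero.1 (h.antisymm ((extAbs l L).nonneg _))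
  refine (smul_eq_zero.1 h1).resolve_right (pow_ne_zero _ fun h => ?_)
  exact (extAbs_unif_pos hπ).ne' (by rw [h, map_zero])

theorem exists_eq_sum_smul_pow (hfin : Module.finrank K L = l) (z : L) :
    ∃ a : Fin l → K, z = ∑ j, a j • π ^ (j : ℕ) := by
  have : Nonempty (Fin l) := ⟨⟨0, (Fact.out : l.Prime).pos⟩⟩
  let b := basisOfLinearIndependentOfCardEqFinrank (linearIndependent_pow_unif hπ)
    (by rw [hfin, Fintype.card_fin])
  refine ⟨b.repr z, (b.sum_repr z).symm.trans ?_⟩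
  simp [b]

theorem baseAbs_le_one_of_extAbs_smul_pow {a : K} {i : Fin l}
    (h : extAbs l L (a • π ^ (i : ℕ)) ≤ 1) : baseAbs l K a ≤ 1 := by
  rcases eq_or_ne a 0 with rfl | h0
  · simp
  obtain ⟨k, hk⟩ := exists_baseAbs_eq_zpow l K h0
  have h1 := pow_le_one₀ (n := l) ((extAbs l L).nonneg _) h
  rw [extAbs_smul_pow_pow hπ hk, ← zpow_zero (unifAbs l K), unifAbs_zpow_le] at h1
  rw [hk, ← zpow_zero (unifAbs l K), unifAbs_zpow_le]
  have := i.2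
  by_contra! hneg
  nlinarith

/-- By orthogonality it suffices to treat one term a π^i, whose absolute value is an integral power
of |π|. Thus π generates the maximal ideal of 𝔬_L. -/
theorem extAbs_le_unif_of_lt_one (hfin : Module.finrank K L = l) {z : L} (hz : extAbs l L z < 1) :
    extAbs l L z ≤ extAbs l L π := by
  obtain ⟨a, rfl⟩ := exists_eq_sum_smul_pow hπ hfin z
  refine abv_sum_le isNonarchimedean_extAbs _ _ ((extAbs l L).nonneg _) fun i _ => ?_
  have h := (extAbs_smul_pow_le_sum hπ a i).trans_lt hz
  rcases eq_or_ne (a i) 0 with h0 | h0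
  · rw [h0, zero_smul, map_zero]; exact (extAbs l L).nonneg _
  obtain ⟨k, hk⟩ := exists_baseAbs_eq_zpow l K h0
  have hl := (Fact.out : l.Prime)
  have h1 := pow_lt_one₀ ((extAbs l L).nonneg _) h hl.ne_zero
  rw [extAbs_smul_pow_pow hπ hk, ← zpow_zero (unifAbs l K), unifAbs_zpow_lt] at h1
  refine le_of_pow_le_pow_left₀ hl.ne_zero ((extAbs l L).nonneg _) ?_
  rw [extAbs_smul_pow_pow hπ hk, hπ]
  conv_rhs => rw [← zpow_one (unifAbs l K)]
  rw [unifAbs_zpow_le]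
  omega

theorem mem_maximalIdeal_pow_extIntegers_iff [Algebra.IsAlgebraic K L]
    (hfin : Module.finrank K L = l) (x : extIntegers l K L) (n : ℕ) :
    x ∈ maximalIdeal (extIntegers l K L) ^ n ↔ extAbs l L x ≤ extAbs l L π ^ n :=
  mem_maximalIdeal_pow_iff_abv_le (v := extAbs l L) (mem_extIntegers_iff l K L)
    (extAbs_unif_lt_one hπ) (fun _ => extAbs_le_unif_of_lt_one hπ hfin) x n

/-- Elements of 𝔭 have absolute value at most |π|^l ≤ |π|^2, so 𝔭 generates an ideal inside the
square of the maximal ideal, which does not contain π. -/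
theorem not_isUnramifiedExt [Algebra.IsAlgebraic K L] (hfin : Module.finrank K L = l) :
    ¬ IsUnramifiedExt l K L := by
  intro h
  have hl := (Fact.out : l.Prime)
  have h0 := extAbs_unif_pos hπ
  have h1 := extAbs_unif_lt_one hπ
  have hle : (maximalIdeal (integers l K)).map (algebraMap (integers l K) (extIntegers l K L)) ≤
      maximalIdeal (extIntegers l K L) ^ 2 := by
    rw [Ideal.map_le_iff_le_comap]
    intro x hx
    rw [Ideal.mem_comap, mem_maximalIdeal_pow_extIntegers_iff hπ hfin]
    change baseAbs l K x ≤ _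
    rw [← pow_one (maximalIdeal (integers l K)), mem_maximalIdeal_pow_iff, pow_one, ← hπ] at hx
    exact hx.trans (pow_le_pow_of_le_one h0.le h1.le hl.two_le)
  rw [show _ = _ from h] at hle
  have hmem : (⟨π, (mem_extIntegers_iff l K L _).2 h1.le⟩ : extIntegers l K L) ∈
      maximalIdeal (extIntegers l K L) := by
    rw [← pow_one (maximalIdeal (extIntegers l K L)), mem_maximalIdeal_pow_extIntegers_iff hπ hfin,
      pow_one]
  have := (mem_maximalIdeal_pow_extIntegers_iff hπ hfin _ _).1 (hle hmem)
  change extAbs l L π ≤ _ at this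
  nlinarith

/-- The powers of a uniformizer form an integral basis of a totally ramified extension. -/
theorem exists_basis_extIntegers (hfin : Module.finrank K L = l) :
    ∃ b : Module.Basis (Fin l) (integers l K) (extIntegers l K L),
      ∀ i, ((b i : extIntegers l K L) : L) = π ^ (i : ℕ) := by
  refine exists_basis_of_linearIndependent (K := K) Subtype.val_injective (fun i => ?_)
    (linearIndependent_pow_unif hπ) fun z hz => ?_
  · exact pow_mem ((mem_extIntegers_iff l K L _).2 (extAbs_unif_lt_one hπ).le) _
  · obtain ⟨a, ha⟩ := exists_eq_sum_smul_pow hπ hfin z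
    refine ⟨fun i => ⟨a i, (mem_integers_iff l K _).2 ?_⟩, ha⟩
    refine baseAbs_le_one_of_extAbs_smul_pow hπ (i := i) ?_
    refine (extAbs_smul_pow_le_sum hπ a i).trans ?_
    rw [← ha]
    exact (mem_extIntegers_iff l K L _).1 hz

/-! ### Discriminant and ramification break from the displacement of π -/

variable {t : ℕ} (ht : ∀ f g : L →ₐ[K] AlgebraicClosure K, f ≠ g →
  closureAbs l K (f π - g π) = extAbs l L π ^ (t + 1))
include ht

/-- The discriminant is the product of the squared differences of conjugates of π over l(l-1)/2
pairs. Each square has size |π|^(2(t+1)), and |π|^l = c. -/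
theorem baseAbs_discr_powerBasis [FiniteDimensional K L] [Algebra.IsSeparable K L]
    (hfin : Module.finrank K L = l) :
    baseAbs l K (Algebra.discr K fun i : Fin l => π ^ (i : ℕ)) = unifAbs l K ^ ((l - 1) * (t + 1)) := by
  have : Nonempty (Fin l) := ⟨⟨0, (Fact.out : l.Prime).pos⟩⟩
  let b := basisOfLinearIndependentOfCardEqFinrank (linearIndependent_pow_unif hπ)
    (by rw [hfin, Fintype.card_fin])
  have hb : ∀ i, b i = π ^ (i : ℕ) := fun i => by simp [b]
  let pb : PowerBasis K L := ⟨π, l, b, hb⟩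
  have e : Fin l ≃ (L →ₐ[K] AlgebraicClosure K) := (Fintype.equivFinOfCardEq (by
    rw [AlgHom.card, hfin])).symm
  have h := Algebra.discr_powerBasis_eq_prod K (AlgebraicClosure K) pb e
  have hpb : (pb.basis : Fin l → L) = fun i : Fin l => π ^ (i : ℕ) := funext hb
  change algebraMap K _ (Algebra.discr K (pb.basis : Fin l → L)) =
    ∏ i : Fin l, ∏ j ∈ Finset.Ioi i, (e j π - e i π) ^ 2 at h
  rw [hpb] at h
  rw [← closureAbs_algebraMap, h, map_prod]
  have hinner : ∀ i : Fin l, closureAbs l K (∏ j ∈ Finset.Ioi i, (e j π - e i π) ^ 2) =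
      (extAbs l L π ^ (t + 1)) ^ (2 * (l - 1 - (i : ℕ))) := by
    intro i
    rw [map_prod, Finset.prod_eq_pow_card (b := (extAbs l L π ^ (t + 1)) ^ 2), Fin.card_Ioi,
      ← pow_mul]
    intro j hj
    rw [map_pow, ht _ _ fun h => (Finset.mem_Ioi.1 hj).ne' (e.injective h)]
  rw [Finset.prod_congr rfl fun i _ => hinner i, Finset.prod_pow_eq_pow_sum,
    Fin.sum_univ_eq_sum_range (fun i => 2 * (l - 1 - i)) l, ← Finset.mul_sum,
    Finset.sum_range_reflect (fun i => i) l, mul_comm 2, Finset.sum_range_id_mul_two, ← hπ,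
    ← pow_mul, ← pow_mul]
  congr 1
  ring

theorem discrValuationEq [FiniteDimensional K L] [Algebra.IsSeparable K L]
    (hfin : Module.finrank K L = l) : DiscrValuationEq l K L ((l - 1) * (t + 1)) := by
  obtain ⟨b, hb⟩ := exists_basis_extIntegers hπ hfin
  refine ⟨⟨l, ⟨b⟩⟩, fun n b' => ?_⟩
  -- The substitution keeps the name n for the prime from here on. Two integral bases then differ by
  -- a matrix with unit determinant, whose square does not affect the valuation.
  obtain rfl : n = l := by
    have h := Fintype.card_congr (b'.indexEquiv b)
    simpa using h
  rw [addVal_eq_iff, ← baseAbs_discr_powerBasis hπ ht hfin]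
  have h1 := Algebra.discr_of_matrix_vecMul (A := integers n K) b (b.toMatrix b')
  rw [b.toMatrix_map_vecMul] at h1
  have hu : IsUnit (b.toMatrix b').det := by
    let := b.invertibleToMatrix b'
    exact Matrix.isUnit_det_of_invertible _
  have h2 := (isUnit_integers_iff n K _).1 hu
  rw [h1, Subalgebra.coe_mul, Subalgebra.coe_pow, map_mul, map_pow, h2, one_pow, one_mul,
    algebraMap_discr_extIntegers]
  simp only [hb]

/-- Since 𝔬_L = 𝔬[π] and σπ^i - π^i is a multiple of σπ - π, no integer is moved further than π, and
π is moved by exactly |π|^{t+1}. -/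
theorem isRamificationBreak [Algebra.IsAlgebraic K L] (hfin : Module.finrank K L = l) :
    IsRamificationBreak l K L t := by
  have hv := isNonarchimedean_extAbs (l := l) (L := L)
  have h0 := extAbs_unif_pos hπ
  have h1 := extAbs_unif_lt_one hπ
  have hσ : ∀ σ : Gal(L/K), σ ≠ 1 → extAbs l L (σ π - π) = extAbs l L π ^ (t + 1) := by
    intro σ hne
    refine ht (L.val.comp (σ : L →ₐ[K] L)) L.val fun h => hne ?_
    ext x
    exact congrArg (fun f : L →ₐ[K] AlgebraicClosure K => f x) h
  have e1 : ((t : ℤ) + 1).toNat = t + 1 := by omega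
  have e2 : ((t : ℤ) + 1 + 1).toNat = t + 2 := by omega
  refine ⟨by omega, ?_, ?_⟩
  · rw [eq_top_iff]
    intro σ _
    rw [ramificationGroup, e1]
    refine AddSubgroup.mem_inertia.2 fun z => ?_
    rw [Submodule.mem_toAddSubgroup, mem_maximalIdeal_pow_extIntegers_iff hπ hfin]
    change extAbs l L (σ z - z) ≤ _
    rcases eq_or_ne σ 1 with rfl | hne
    · rw [AlgEquiv.one_apply, sub_self, map_zero]
      positivity
    obtain ⟨a, ha⟩ := exists_eq_sum_smul_pow hπ hfin (z : L)
    rw [ha, map_sum, ← Finset.sum_sub_distrib]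
    refine abv_sum_le hv _ _ (by positivity) fun i _ => ?_
    have ha1 : baseAbs l K (a i) ≤ 1 := by
      refine baseAbs_le_one_of_extAbs_smul_pow hπ (i := i) ?_
      refine (extAbs_smul_pow_le_sum hπ a i).trans ?_
      rw [← ha]
      exact (mem_extIntegers_iff l K L _).1 z.2
    rw [map_smul, map_pow, ← smul_sub, Algebra.smul_def, map_mul, extAbs_algebraMap, ← hσ σ hne]
    refine (mul_le_of_le_one_left ((extAbs l L).nonneg _) ha1).trans ?_
    exact abv_pow_sub_pow_le hv (by rw [extAbs_algEquiv]; exact h1.le) h1.le _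
  · rw [eq_bot_iff]
    intro σ hmem
    rw [ramificationGroup, e2] at hmem
    rw [Subgroup.mem_bot]
    by_contra hne
    have h := AddSubgroup.mem_inertia.1 hmem ⟨π, (mem_extIntegers_iff l K L _).2 h1.le⟩
    rw [Submodule.mem_toAddSubgroup, mem_maximalIdeal_pow_extIntegers_iff hπ hfin] at h
    change extAbs l L (σ π - π) ≤ _ at h
    rw [hσ σ hne] at h
    exact (pow_lt_pow_right_of_lt_one₀ h0 h1 (Nat.lt_succ_self (t + 1))).not_ge h

end TotallyRamified

/-! ### Kummer theory for a line -/

section Kummer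

open Polynomial IntermediateField

variable {l : ℕ} [Fact l.Prime] {K : Type*} [Field K] {ζ : K} (hζ : IsPrimitiveRoot ζ l)

theorem minpoly_kummer_root {F : Type*} [Field F] [Algebra K F] {u : Kˣ}
    (hu : (u : KummerQuotient l K) ≠ 1) {α : F} (hα : α ^ l = algebraMap K F u) :
    minpoly K α = X ^ l - C (u : K) := by
  have hl := (Fact.out : l.Prime)
  have hirr : Irreducible (X ^ l - C (u : K)) := by
    refine X_pow_sub_C_irreducible_of_prime hl fun b hb => hu ?_
    have hb0 : b ≠ 0 := by
      rintro rfl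
      rw [zero_pow hl.ne_zero] at hb
      exact u.ne_zero hb.symm
    rw [← QuotientGroup.mk_one, eq_comm, kummerQuotient_eq_iff]
    exact ⟨Units.mk0 b hb0, Units.ext (by simp [hb])⟩
  exact (minpoly.eq_of_irreducible_of_monic hirr (by simp [hα])
    (monic_X_pow_sub_C _ hl.ne_zero)).symm

theorem natDegree_minpoly_kummer_root {F : Type*} [Field F] [Algebra K F] {u : Kˣ}
    (hu : (u : KummerQuotient l K) ≠ 1) {α : F} (hα : α ^ l = algebraMap K F u) :
    (minpoly K α).natDegree = l := by
  rw [minpoly_kummer_root hu hα, natDegree_X_pow_sub_C]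

include hζ in
/-- For a line `D`, the extension `K(D^{1/l})` is generated by an `l`-th root of any element of
`K^×` whose class generates `D`. -/
theorem kummerExtension_eq_adjoin {D : Subgroup (KummerQuotient l K)} (hD : Nat.card D = l)
    {u : Kˣ} (huD : (u : KummerQuotient l K) ∈ D) (hu : (u : KummerQuotient l K) ≠ 1)
    {α : AlgebraicClosure K} (hα : α ^ l = algebraMap K (AlgebraicClosure K) u) :
    kummerExtension l K D = K⟮α⟯ := by
  have hl := (Fact.out : l.Prime)
  have : NeZero l := ⟨hl.ne_zero⟩
  have hα0 : α ≠ 0 := by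
    rintro rfl
    rw [zero_pow hl.ne_zero, eq_comm, map_eq_zero] at hα
    exact u.ne_zero hα
  have hmem := mem_adjoin_simple_self K α
  refine le_antisymm (adjoin_le_iff.2 ?_) (adjoin_simple_le_iff.2 (subset_adjoin K _ ⟨u, huD, hα⟩))
  rintro x ⟨w, hwD, hx⟩
  -- D has prime order, so w = u^k b^l. Then x and β = α^k b have the same l-th power and differ by
  -- a root of unity, which lies in K.
  obtain ⟨k, hk⟩ := Subgroup.mem_zpowers_iff.1 (mem_zpowers_of_prime_card hD
    (g := ⟨_, huD⟩) (g' := ⟨_, hwD⟩) (fun h => hu (congrArg Subtype.val h)))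
  have hk' : ((u ^ k : Kˣ) : KummerQuotient l K) = w := congrArg Subtype.val hk
  obtain ⟨b, hb⟩ := kummerQuotient_eq_iff.1 hk'
  set β : AlgebraicClosure K := α ^ k * algebraMap K _ b with hβ
  have hb0 : algebraMap K (AlgebraicClosure K) b ≠ 0 := (_root_.map_ne_zero _).2 b.ne_zero
  have hβ0 : β ≠ 0 := mul_ne_zero (zpow_ne_zero _ hα0) hb0
  have hβl : β ^ l = x ^ l := by
    rw [hx, hb, hβ, mul_pow, ← zpow_natCast (α ^ k), zpow_comm, zpow_natCast, hα]
    rw [Units.val_mul, Units.val_pow_eq_pow_val, Units.val_zpow_eq_zpow_val, map_mul, map_pow,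
      map_zpow₀]
  have h1 : (x / β) ^ l = 1 := by rw [div_pow, hβl, div_self (hβl ▸ pow_ne_zero _ hβ0)]
  obtain ⟨i, -, hi⟩ := (hζ.map_of_injective
    (algebraMap K (AlgebraicClosure K)).injective).eq_pow_of_pow_eq_one h1
  rw [eq_div_iff hβ0] at hi
  rw [← hi, hβ]
  change _ ∈ K⟮α⟯
  exact mul_mem (pow_mem (K⟮α⟯.algebraMap_mem _) _)
    (mul_mem (zpow_mem hmem _) (K⟮α⟯.algebraMap_mem _))

theorem finrank_adjoin_kummer_root {F : Type*} [Field F] [Algebra K F] {u : Kˣ}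
    (hu : (u : KummerQuotient l K) ≠ 1) {α : F} (hα : α ^ l = algebraMap K F u) :
    Module.finrank K K⟮α⟯ = l := by
  have hl := (Fact.out : l.Prime)
  have hint : IsIntegral K α := .of_pow hl.pos (hα ▸ isIntegral_algebraMap)
  rw [adjoin.finrank hint, natDegree_minpoly_kummer_root hu hα]

include hζ in
theorem isGalois_isCyclic_adjoin_kummer_root {F : Type*} [Field F] [Algebra K F] {u : Kˣ}
    (hu : (u : KummerQuotient l K) ≠ 1) {α : F} (hα : α ^ l = algebraMap K F u) :
    IsGalois K K⟮α⟯ ∧ IsCyclic Gal(K⟮α⟯/K) := by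
  have hl := (Fact.out : l.Prime)
  have hint : IsIntegral K α := .of_pow hl.pos (hα ▸ isIntegral_algebraMap)
  have hfin := finrank_adjoin_kummer_root hu hα
  have : FiniteDimensional K K⟮α⟯ := adjoin.finiteDimensional hint
  have hgen : AdjoinSimple.gen K α ^ l = algebraMap K K⟮α⟯ u := Subtype.ext hα
  have key := (isCyclic_tfae K K⟮α⟯ (by
    rw [hfin]
    exact ⟨ζ, (mem_primitiveRoots hl.pos).2 hζ⟩)).out 0 2
  refine key.2 ⟨AdjoinSimple.gen K α, ?_, ?_⟩
  · rw [hfin]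
    exact ⟨u, hgen.symm⟩
  · have hdeg : (minpoly K (AdjoinSimple.gen K α)).natDegree = l :=
      natDegree_minpoly_kummer_root hu hgen
    have h := adjoin.finrank (K := K) (IsIntegral.of_finite K (AdjoinSimple.gen K α))
    rw [hdeg, ← hfin] at h
    exact eq_of_le_of_finrank_eq le_top (h.trans finrank_top'.symm)

end Kummer

/-! ### From the Kummer generator to a uniformizer -/

section Main

open IntermediateField

variable {l : ℕ} [Fact l.Prime]
variable {K : Type*} [Field K] [Algebra ℚ_[l] K] [FiniteDimensional ℚ_[l] K]

/-- Distinct embeddings of a Kummer extension move the generator by a nontrivial root of unity. -/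
theorem closureAbs_algHom_sub {ζ : K} (hζ : IsPrimitiveRoot ζ l) {u : K} {α : AlgebraicClosure K}
    (hα : α ^ l = algebraMap K (AlgebraicClosure K) u) {f g : K⟮α⟯ →ₐ[K] AlgebraicClosure K}
    (hfg : f ≠ g) : closureAbs l K (f (AdjoinSimple.gen K α) - g (AdjoinSimple.gen K α)) =
      baseAbs l K (ζ - 1) * closureAbs l K α := by
  have hl := (Fact.out : l.Prime)
  set γ := AdjoinSimple.gen K α
  have hne : f γ ≠ g γ := fun h => hfg (adjoin_algHom_ext K fun x hx => by
    obtain rfl : x = α := hx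
    exact h)
  have hpow : ∀ h : K⟮α⟯ →ₐ[K] AlgebraicClosure K, h γ ^ l = algebraMap K _ u := fun h => by
    rw [← map_pow, show γ ^ l = algebraMap K K⟮α⟯ u from Subtype.ext hα, AlgHom.commutes]
  have hg0 : g γ ≠ 0 := fun h0 => by
    have h1 := hpow g
    rw [h0, zero_pow hl.ne_zero] at h1
    have h2 := hpow f
    rw [← h1] at h2
    exact hne ((pow_eq_zero_iff hl.ne_zero).1 h2 |>.trans h0.symm)
  have hη : IsPrimitiveRoot (f γ / g γ) l := by
    have h1 : (f γ / g γ) ^ l = 1 := by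
      rw [div_pow, hpow f, ← hpow g, div_self (pow_ne_zero _ hg0)]
    rw [← orderOf_eq_prime h1 fun h => hne ((div_eq_one_iff_eq hg0).1 h)]
    exact IsPrimitiveRoot.orderOf _
  have h1 := abv_sub_one_eq_of_primitiveRoot (isNonarchimedean_closureAbs l K) hl.ne_zero
    (hζ.map_of_injective (algebraMap K (AlgebraicClosure K)).injective) hη
  rw [← map_one (algebraMap K (AlgebraicClosure K)), ← map_sub (algebraMap _ _),
    closureAbs_algebraMap, map_one, div_sub_one hg0, map_div₀, closureAbs_algHom] at h1
  have hα0 : closureAbs l K (γ : AlgebraicClosure K) ≠ 0 := by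
    rw [← closureAbs_algHom l K _ g]
    exact (closureAbs l K).ne_zero hg0
  rw [div_eq_iff hα0] at h1
  exact h1

variable [Algebra ℤ_[l] K] [IsScalarTower ℤ_[l] ℚ_[l] K]

/-- From an element whose valuation has denominator `l`, one obtains a uniformizer on which the
Galois group acts in the same way. -/
theorem exists_unif_of_not_dvd {L : IntermediateField K (AlgebraicClosure K)} {x : L} {s : ℤ}
    (hs : ¬ (l : ℤ) ∣ s) (hx : extAbs l L x ^ l = unifAbs l K ^ s) {t : ℕ} (ht : 0 < t)
    (h : ∀ f g : L →ₐ[K] AlgebraicClosure K, f ≠ g →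
      closureAbs l K (f x - g x) ^ l = unifAbs l K ^ t * unifAbs l K ^ s) :
    ∃ π : L, extAbs l L π ^ l = unifAbs l K ∧ ∀ f g : L →ₐ[K] AlgebraicClosure K, f ≠ g →
      closureAbs l K (f π - g π) = extAbs l L π ^ (t + 1) := by
  have hl := (Fact.out : l.Prime)
  have hc := unifAbs_pos l K
  have hv := isNonarchimedean_closureAbs l K
  -- The Bézout coefficient of s is reduced modulo l to make it a natural number, so that the
  -- binomial estimate for (1 + δ)^a applies; b absorbs the change.
  obtain ⟨a, b, hab⟩ : ∃ (a : ℕ) (b : ℤ), a * s + b * l = 1 := by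
    have hcop : IsCoprime s (l : ℤ) :=
      ((Nat.prime_iff_prime_int.1 hl).coprime_iff_not_dvd.2 hs).symm
    obtain ⟨a, b, hab⟩ := hcop
    have ha := Int.emod_nonneg a (by exact_mod_cast hl.ne_zero : (l : ℤ) ≠ 0)
    refine ⟨(a % l).toNat, b + a / l * s, ?_⟩
    rw [Int.toNat_of_nonneg ha, Int.emod_def, ← hab]
    ring
  have hcop : a.Coprime l := by
    rw [← Nat.isCoprime_iff_coprime]
    exact ⟨s, b, by rw [← hab]; ring⟩
  have ha : closureAbs l K ((a : ℕ) : AlgebraicClosure K) = 1 := by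
    rw [← map_natCast (algebraMap K (AlgebraicClosure K)), closureAbs_algebraMap,
      baseAbs_natCast_of_coprime l K hcop]
  set ϖ : K := (uniformizer l K : K)
  have hϖ : baseAbs l K ϖ = unifAbs l K := rfl
  have hπ : extAbs l L (x ^ a * algebraMap K L (ϖ ^ b)) ^ l = unifAbs l K := by
    rw [map_mul, map_pow, extAbs_algebraMap, map_zpow₀, hϖ, mul_pow, ← pow_mul, mul_comm a,
      pow_mul, hx, ← zpow_natCast, ← zpow_natCast, ← zpow_mul, ← zpow_mul, ← zpow_add₀ hc.ne',
      mul_comm s, hab, zpow_one]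
  refine ⟨_, hπ, fun f g hfg => ?_⟩
  set π : L := x ^ a * algebraMap K L (ϖ ^ b) with hπdef
  have hgx : closureAbs l K (g x) = extAbs l L x := closureAbs_algHom l K L g x
  have hgx0 : g x ≠ 0 := fun h0 => by
    rw [← hgx, h0, map_zero, zero_pow hl.ne_zero] at hx
    exact (zpow_ne_zero s hc.ne') hx.symm
  -- Here δ = fx/gx - 1. The factor ϖ^b lies in K, so fπ/gπ = (1 + δ)^a, and |(1 + δ)^a - 1| = |δ| =
  -- |π|^t.
  set δ := (f x - g x) / g x with hδdef
  have hδ : closureAbs l K δ ^ l = unifAbs l K ^ t := by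
    rw [hδdef, map_div₀, div_pow, h f g hfg, hgx, hx]
    exact mul_div_cancel_right₀ _ (zpow_ne_zero _ hc.ne')
  have hδ1 : closureAbs l K δ < 1 := by
    refine lt_of_pow_lt_pow_left₀ l zero_le_one ?_
    rw [hδ, one_pow]
    exact pow_lt_one₀ hc.le (unifAbs_lt_one l K) ht.ne'
  have hfx : f x = g x * (1 + δ) := by
    rw [hδdef]; field_simp; ring
  have hmap : ∀ j : L →ₐ[K] AlgebraicClosure K, j π = j x ^ a * algebraMap K _ (ϖ ^ b) := fun j => by
    rw [hπdef, map_mul, map_pow, AlgHom.commutes]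
  have hsub : f π - g π = g π * ((1 + δ) ^ a - 1) := by
    rw [hmap f, hmap g, hfx, mul_pow]
    ring
  have hδ' : closureAbs l K δ = extAbs l L π ^ t := by
    refine (pow_left_inj₀ ((closureAbs l K).nonneg _)
      (pow_nonneg ((extAbs l L).nonneg _) _) hl.ne_zero).1 ?_
    rw [hδ, ← pow_mul, mul_comm, pow_mul, hπ]
  rw [hsub, map_mul, abv_one_add_pow_sub_one hv hδ1 ha, hδ', closureAbs_algHom, ← extAbs_apply,
    pow_succ']

/-- Embeddings fix ε, so α - ε is displaced exactly as α is. -/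
theorem exists_unif_adjoin {ζ : K} (hζ : IsPrimitiveRoot ζ l) {u ε : K} {α : AlgebraicClosure K}
    (hα : α ^ l = algebraMap K (AlgebraicClosure K) u) {s : ℤ} (hs : ¬ (l : ℤ) ∣ s)
    (hx : closureAbs l K (α - algebraMap K (AlgebraicClosure K) ε) ^ l = unifAbs l K ^ s)
    {t : ℕ} (ht : 0 < t)
    (h : (baseAbs l K (ζ - 1) * closureAbs l K α) ^ l = unifAbs l K ^ t * unifAbs l K ^ s) :
    ∃ π : K⟮α⟯, extAbs l K⟮α⟯ π ^ l = unifAbs l K ∧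
      ∀ f g : K⟮α⟯ →ₐ[K] AlgebraicClosure K, f ≠ g →
        closureAbs l K (f π - g π) = extAbs l K⟮α⟯ π ^ (t + 1) := by
  have hx' : extAbs l K⟮α⟯ (AdjoinSimple.gen K α - algebraMap K K⟮α⟯ ε) ^ l = unifAbs l K ^ s := hx
  refine exists_unif_of_not_dvd hs hx' ht fun f g hfg => ?_
  rw [map_sub f, map_sub g, AlgHom.commutes, AlgHom.commutes, sub_sub_sub_cancel_right,
    closureAbs_algHom_sub hζ hα hfg, h]

end Main

end LocalKummer

theorem proposition60 (l : ℕ) [Fact l.Prime] (K : Type*) [Field K] [Algebra ℚ_[l] K]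
    [Algebra ℤ_[l] K] [IsScalarTower ℤ_[l] ℚ_[l] K] [FiniteDimensional ℚ_[l] K]
    (hζ : ∃ ζ : K, IsPrimitiveRoot ζ l)
    (D : Subgroup (LocalKummer.KummerQuotient l K)) (hD : Nat.card D = l)
    (hne : D ≠ LocalKummer.unitFiltration l K (l * LocalKummer.e₁ l K)) :
    -- the quotient `e₁ = e / (l - 1)` is exact
    (l - 1) * LocalKummer.e₁ l K = LocalKummer.absRamificationIndex l K ∧
    -- the level exists, is unique, and is less than `l e₁`
    (∃! m : ℕ, LocalKummer.HasLevel l K D m) ∧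
    ∀ m : ℕ, LocalKummer.HasLevel l K D m →
      m < l * LocalKummer.e₁ l K ∧
      -- `L = K(D^{1/l})` is a ramified cyclic extension of degree `l`
      Module.finrank K (LocalKummer.kummerExtension l K D) = l ∧
      IsGalois K (LocalKummer.kummerExtension l K D) ∧
      IsCyclic Gal(LocalKummer.kummerExtension l K D/K) ∧
      ¬ LocalKummer.IsUnramifiedExt l K (LocalKummer.kummerExtension l K D) ∧
      -- `v_K(d_{L|K}) = (l - 1)(1 + l e₁ - m)`
      LocalKummer.DiscrValuationEq l K (LocalKummer.kummerExtension l K D)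
        ((l - 1) * (1 + l * LocalKummer.e₁ l K - m)) ∧
      -- the ramification break is `t = l e₁ - m`
      LocalKummer.IsRamificationBreak l K (LocalKummer.kummerExtension l K D)
        ((l : ℤ) * LocalKummer.e₁ l K - m) := by
  obtain ⟨ζ, hζ⟩ := hζ
  have hl := (Fact.out : l.Prime)
  refine ⟨(LocalKummer.exists_baseAbs_zeta_sub_one_eq hζ).2,
    LocalKummer.existsUnique_hasLevel hζ hD hne, fun m hm => ?_⟩
  have hlt := hm.lt hζ hD hne
  obtain ⟨u, huD, hu, hgen⟩ := hm.exists_generator hζ hlt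
  obtain ⟨α, hα⟩ := IsAlgClosed.exists_pow_nat_eq
    (algebraMap K (AlgebraicClosure K) u) hl.pos
  obtain ⟨ε, s, hs, hx, hmove⟩ := hgen α hα
  rw [LocalKummer.kummerExtension_eq_adjoin hζ hD huD hu hα]
  have hfin := LocalKummer.finrank_adjoin_kummer_root hu hα
  obtain ⟨hgal, hcyc⟩ := LocalKummer.isGalois_isCyclic_adjoin_kummer_root hζ hu hα
  have : FiniteDimensional K (IntermediateField.adjoin K {α}) :=
    Module.finite_of_finrank_pos (by rw [hfin]; exact hl.pos)
  obtain ⟨π, hπ, hbreak⟩ :=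
    LocalKummer.exists_unif_adjoin hζ hα hs hx (Nat.sub_pos_of_lt hlt) hmove
  -- The subtractions are truncated in ℕ; m < le₁ makes them agree with those in ℤ.
  have h1 : 1 + l * LocalKummer.e₁ l K - m = l * LocalKummer.e₁ l K - m + 1 := by omega
  have h2 : (l : ℤ) * LocalKummer.e₁ l K - m = ((l * LocalKummer.e₁ l K - m : ℕ) : ℤ) := by
    push_cast [hlt.le]
    ring
  rw [h1, h2]
  exact ⟨hlt, hfin, hgal, hcyc, LocalKummer.not_isUnramifiedExt hπ hfin,
    LocalKummer.discrValuationEq hπ hbreak hfin, LocalKummer.isRamificationBreak hπ hbreak hfin⟩
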